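/- A \emph{rooted planar map} is a connected planar graph (loops and multiple edges allowed) with at least one edge, embedded in the oriented sphere, with a distinguished edge (the \emph{root edge}) that is given a direction, called the root direction; such maps are taken up to orientation-preserving homeomorphisms of the sphere that respect the root. A \emph{(rooted) Eulerian partial orientation} is a rooted planar map in which some (possibly none, possibly all) of the edges are directed, the others being left undirected, in such a way that every vertex has equal in-degree and out-degree; the root edge may be undirected, directed along the root direction, or directed against it. A \emph{rooted quartic Eulerian orientation} is a rooted planar map in which all vertices have degree $4$ and all edges are directed, with in-degree equal to out-degree at every vertex, and such that the root direction is the direction of the root edge in the orientation. A vertex of a quartic Eulerian orientation is \emph{alternating} if the four half-edges met around it are alternately outgoing and incoming. Let $$Q(t,\gamma)=\sum_{O} t^{v(O)}\gamma^{a(O)}\in\mathbb{N}[\gamma][[t]],$$ where the sum runs over all rooted quartic Eulerian orientations $O$, and $v(O)$ and $a(O)$ are the numbers of vertices and of alternating vertices of $O$. Then $$Q(t,\gamma)=\sum_{P} t^{e(P)}\gamma^{u(P)},$$ where the sum runs over all rooted Eulerian partial orientations $P$, and $e(P)$ and $u(P)$ are the numbers of edges and of undirected edges of $P$. -/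

import Mathlib

open Equiv

/-- The set of cycles (fixed points included) of a permutation. -/
abbrev PermCycles {D : Type} (p : Perm D) : Type := Quotient (Perm.SameCycle.setoid p)

/-- A rooted planar map whose set of darts (half-edges) is `D`.  Loops and multiple edges are allowed.
Vertices, edges and faces are the cycles of `rot`, `opp` and `rot * opp`. -/
structure RootedPlanarMap (D : Type) where
  /-- The next dart, in counterclockwise order, around the vertex from which a dart emanates. -/
  rot : Perm D
  /-- The other dart of the same edge. -/
  opp : Perm D
  opp_opp : ∀ d, opp (opp d) = d
  opp_ne : ∀ d, opp d ≠ d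
  /-- The root dart: the root edge with a choice of direction. -/
  root : D
  connected : ∀ x y : D, ∃ g ∈ Subgroup.closure ({rot, opp} : Set (Perm D)), g x = y
  /-- Euler's relation: the surface is the sphere. -/
  planar : Nat.card (PermCycles rot) + Nat.card (PermCycles (rot * opp))
    = Nat.card (PermCycles opp) + 2

namespace RootedPlanarMap

variable {D : Type}

abbrev Vertex (M : RootedPlanarMap D) : Type := PermCycles M.rot

abbrev Edge (M : RootedPlanarMap D) : Type := PermCycles M.opp

/-- The vertex from which a dart emanates. -/
def vertexOf (M : RootedPlanarMap D) (d : D) : M.Vertex := Quotient.mk _ d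

/-- The edge that contains a dart. -/
def edgeOf (M : RootedPlanarMap D) (d : D) : M.Edge := Quotient.mk _ d

end RootedPlanarMap

/-- A rooted planar map with an Eulerian partial orientation.  The value `dir d` is `1` if the
edge of `d` is directed away from the vertex of `d` along `d`, it is `-1` if this edge is directed
towards the vertex of `d` along `d`, and it is `0` if this edge is undirected. -/
structure PartialEulerian (D : Type) extends RootedPlanarMap D where
  dir : D → SignType
  dir_opp : ∀ d, dir (opp d) = - dir d
  eulerian : ∀ v : toRootedPlanarMap.Vertex,
    Nat.card {d : D // toRootedPlanarMap.vertexOf d = v ∧ dir d = 1}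
      = Nat.card {d : D // toRootedPlanarMap.vertexOf d = v ∧ dir d = -1}

namespace PartialEulerian

variable {D : Type}

/-- The number of undirected edges. -/
noncomputable def undirectedCount (M : PartialEulerian D) : ℕ :=
  Nat.card {e : M.Edge // ∀ d, M.edgeOf d = e → M.dir d = 0}

/-- The number of alternating vertices: in cyclic order around such a vertex, every outgoing dart
is followed by an incoming one and conversely. -/
noncomputable def alternatingCount (M : PartialEulerian D) : ℕ :=
  Nat.card {v : M.Vertex // ∀ d, M.vertexOf d = v → M.dir (M.rot d) = - M.dir d}

/-- Every vertex has degree 4, every edge is directed, and the root edge carries its canonical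
direction, i.e. the root dart follows the orientation. -/
structure IsQuarticOrientation (M : PartialEulerian D) : Prop where
  degree : ∀ v : M.Vertex, Nat.card {d : D // M.vertexOf d = v} = 4
  directed : ∀ d, M.dir d ≠ 0
  root_dir : M.dir M.root = 1

/-- A relabelling of the darts that preserves the rooted map and its partial orientation. -/
structure IsIso (f : Perm D) (M N : PartialEulerian D) : Prop where
  rot : ∀ d, f (M.rot d) = N.rot (f d)
  opp : ∀ d, f (M.opp d) = N.opp (f d)
  root : f M.root = N.root
  dir : ∀ d, N.dir (f d) = M.dir d

theorem IsIso.refl (M : PartialEulerian D) : IsIso 1 M M :=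
  ⟨fun _ => rfl, fun _ => rfl, rfl, fun _ => rfl⟩

theorem IsIso.symm {f : Perm D} {M N : PartialEulerian D} (h : IsIso f M N) :
    IsIso f⁻¹ N M where
  rot d := f.injective (by simp [h.rot])
  opp d := f.injective (by simp [h.opp])
  root := f.injective (by simp [h.root])
  dir d := by simp [← h.dir]

theorem IsIso.trans {f g : Perm D} {M N P : PartialEulerian D} (h : IsIso f M N)
    (k : IsIso g N P) : IsIso (g * f) M P where
  rot d := by simp [h.rot, k.rot]
  opp d := by simp [h.opp, k.opp]
  root := by simp [h.root, k.root]
  dir d := by simp [h.dir, k.dir]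

/-- Isomorphism of rooted partially oriented maps. -/
instance isoSetoid (D : Type) : Setoid (PartialEulerian D) where
  r M N := ∃ f : Perm D, IsIso f M N
  iseqv :=
    { refl := fun M => ⟨1, IsIso.refl M⟩
      symm := fun ⟨_, h⟩ => ⟨_, h.symm⟩
      trans := fun ⟨_, h⟩ ⟨_, k⟩ => ⟨_, h.trans k⟩ }

theorem sameCycle_iff_of_conj {f p q : Perm D} (h : ∀ d, f (p d) = q (f d)) (x y : D) :
    p.SameCycle x y ↔ q.SameCycle (f x) (f y) := by
  have hq : q = f * p * f⁻¹ := by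
    ext d
    simp [h]
  rw [hq, Perm.sameCycle_conj]
  simp

theorem IsIso.undirectedCount_eq {f : Perm D} {M N : PartialEulerian D} (h : IsIso f M N) :
    M.undirectedCount = N.undirectedCount := by
  refine Nat.card_congr ((Quotient.congr f (sameCycle_iff_of_conj h.opp)).subtypeEquiv ?_)
  intro e
  induction e using Quotient.inductionOn with
  | h x =>
    refine ⟨fun H d hd => ?_, fun H d hd => ?_⟩
    · obtain ⟨d, rfl⟩ := f.surjective d
      rw [h.dir]
      exact H d (Quotient.sound ((sameCycle_iff_of_conj h.opp d x).2 (Quotient.exact hd)))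
    · rw [← h.dir]
      exact H (f d) (Quotient.sound ((sameCycle_iff_of_conj h.opp d x).1 (Quotient.exact hd)))

theorem IsIso.alternatingCount_eq {f : Perm D} {M N : PartialEulerian D} (h : IsIso f M N) :
    M.alternatingCount = N.alternatingCount := by
  refine Nat.card_congr ((Quotient.congr f (sameCycle_iff_of_conj h.rot)).subtypeEquiv ?_)
  intro e
  induction e using Quotient.inductionOn with
  | h x =>
    refine ⟨fun H d hd => ?_, fun H d hd => ?_⟩
    · obtain ⟨d, rfl⟩ := f.surjective d
      rw [h.dir, ← h.rot, h.dir]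
      exact H d (Quotient.sound ((sameCycle_iff_of_conj h.rot d x).2 (Quotient.exact hd)))
    · rw [← h.dir, ← h.dir, h.rot]
      exact H (f d) (Quotient.sound ((sameCycle_iff_of_conj h.rot d x).1 (Quotient.exact hd)))

instance finite [Finite D] : Finite (PartialEulerian D) := by
  refine Finite.of_injective
    (fun M : PartialEulerian D => (M.rot, M.opp, M.root, M.dir)) ?_
  rintro ⟨⟨r, o, _, _, x, _, _⟩, d, _, _⟩ ⟨⟨r', o', _, _, x', _, _⟩, d', _, _⟩ h
  simp only [Prod.mk.injEq] at h
  obtain ⟨rfl, rfl, rfl, rfl⟩ := h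
  rfl

/-- Quartic Eulerian orientations on the set of darts `D`, rooted canonically. -/
abbrev Quartic (D : Type) : Type := {M : PartialEulerian D // M.IsQuarticOrientation}

/-- Rooted Eulerian partial orientations with `n` edges (that is, `2 * n` darts), up to
isomorphism. -/
abbrev PartialClass (n : ℕ) : Type := Quotient (isoSetoid (Fin (2 * n)))

/-- Rooted quartic Eulerian orientations with `n` vertices (that is, `4 * n` darts), up to
isomorphism. -/
abbrev QuarticClass (n : ℕ) : Type :=
  Quotient ((isoSetoid (Fin (4 * n))).comap (Subtype.val : Quartic (Fin (4 * n)) → _))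

noncomputable instance fintypePartialClass (n : ℕ) : Fintype (PartialClass n) := Fintype.ofFinite _

noncomputable instance fintypeQuarticClass (n : ℕ) : Fintype (QuarticClass n) := Fintype.ofFinite _

noncomputable def PartialClass.undirectedCount {n : ℕ} (c : PartialClass n) : ℕ :=
  Quotient.lift (s := isoSetoid (Fin (2 * n))) PartialEulerian.undirectedCount
    (fun _ _ h => h.elim fun _ k => k.undirectedCount_eq) c

noncomputable def QuarticClass.alternatingCount {n : ℕ} (c : QuarticClass n) : ℕ :=
  Quotient.lift (s := (isoSetoid (Fin (4 * n))).comap Subtype.val)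
    (fun M : Quartic (Fin (4 * n)) => M.1.alternatingCount)
    (fun _ _ h => Exists.elim h fun _ k => k.alternatingCount_eq) c

end PartialEulerian

/-- The series `Q(t, γ)` of rooted quartic Eulerian orientations, as a power series in `t` whose
coefficients are polynomials in `γ`: weight `t` per vertex, and `γ` per alternating vertex. -/
noncomputable def quarticSeries : PowerSeries (Polynomial ℕ) :=
  PowerSeries.mk fun n =>
    ∑ c : PartialEulerian.QuarticClass n, (Polynomial.X : Polynomial ℕ) ^ c.alternatingCount

/-- The series of rooted Eulerian partial orientations, as a power series in `t` whose
coefficients are polynomials in `γ`: weight `t` per edge, and `γ` per undirected edge. -/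
noncomputable def partialSeries : PowerSeries (Polynomial ℕ) :=
  PowerSeries.mk fun n =>
    ∑ c : PartialEulerian.PartialClass n, (Polynomial.X : Polynomial ℕ) ^ c.undirectedCount

/-! The vertices of a quartic orientation `M` become the edges of a partial orientation `P`. The two
outgoing darts at a vertex of `M` are the two darts of the corresponding edge, exchanged by `α`. The
edge is undirected when the vertex is alternating; otherwise the two outgoing darts are consecutive,
and get directions 1 and -1 in this order. What remains to be encoded is, on `M`, the permutation
`κ` telling to which outgoing dart each incoming one is joined, and on `P`, the rotation `σ`.

Around a vertex of `P`, incoming edges read as opening parentheses and outgoing edges as closing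
ones form a balanced cyclic word. The two encodings are related by `κ x = σ (θ x)`, where `θ` sends
a closing dart `x` to the partner of the opening dart `α x` and fixes all other darts (`IsMatched`).
Given `σ`, the matching exists because the word is balanced (`exists_isMatched_of_rot`). Given `κ`,
a first-return construction rebuilds `σ` (`exists_isMatched_of_link`). It requires a height that
drops by `dir` along both `κ` and `α`, and this is where planarity of `M` enters: on the sphere an
Eulerian orientation is the gradient of a function on the faces (`exists_height`).

The faces of `M` correspond to the faces and vertices of `P` together (`card_faces`), and if `P` has
`e` edges then `M` has `e` vertices and `2e` edges, so the two Euler relations are equivalent. Since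
`κ` and `σ` determine each other equivariantly (`equivariant_right`, `equivariant_left`), the
correspondence is a bijection on isomorphism classes. -/

/-! ### Unmatched closing parentheses in a cyclic word -/

/-- `FirstDescent σ dir x g` says that `g` is the first dart, in the order `x, σ x, σ (σ x), …`,
that closes an opening parenthesis preceding `x`, where darts of direction `-1` are opening
parentheses, and darts of direction `1` are closing ones. -/
inductive FirstDescent {E : Type} (σ : Perm E) (dir : E → SignType) : E → E → Prop
  | here {g : E} : dir g = 1 → FirstDescent σ dir g g
  | level {x g : E} : dir x = 0 → FirstDescent σ dir (σ x) g → FirstDescent σ dir x g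
  | ascend {x b g : E} : dir x = -1 → FirstDescent σ dir (σ x) b → FirstDescent σ dir (σ b) g →
      FirstDescent σ dir x g

namespace FirstDescent

variable {E : Type} {σ : Perm E} {dir : E → SignType} {x g b : E}

theorem dir_eq_one (h : FirstDescent σ dir x g) : dir g = 1 := by
  induction h with
  | here h => exact h
  | level _ _ ih => exact ih
  | ascend _ _ _ _ ih => exact ih

theorem unique (h : FirstDescent σ dir x g) : ∀ {g'}, FirstDescent σ dir x g' → g = g' := by
  induction h with
  | here h =>
    intro g' h'
    cases h' with
    | here => rfl
    | level h0 => simp [h] at h0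
    | ascend h0 => simp [h] at h0
  | level h _ ih =>
    intro g' h'
    cases h' with
    | here h0 => simp [h] at h0
    | level _ h1 => exact ih h1
    | ascend h0 => simp [h] at h0
  | ascend h _ _ ih₁ ih₂ =>
    intro g' h'
    cases h' with
    | here h0 => simp [h] at h0
    | level h0 => simp [h] at h0
    | ascend _ h1 h2 =>
      cases ih₁ h1
      exact ih₂ h2

theorem level_iff (h : dir x = 0) : FirstDescent σ dir x g ↔ FirstDescent σ dir (σ x) g := by
  refine ⟨fun h' => ?_, level h⟩
  cases h' with
  | here h0 => simp [h] at h0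
  | level _ h1 => exact h1
  | ascend h0 => simp [h] at h0

theorem ascend_iff (h : dir x = -1) (hb : FirstDescent σ dir (σ x) b) :
    FirstDescent σ dir x g ↔ FirstDescent σ dir (σ b) g := by
  refine ⟨fun h' => ?_, ascend h hb⟩
  cases h' with
  | here h0 => simp [h] at h0
  | level h0 => simp [h] at h0
  | ascend _ h1 h2 => rwa [hb.unique h1]

/-- Equivalence relations containing the graph of `σ` contain `FirstDescent`. -/
theorem rel (r : Setoid E) (hr : ∀ x, r x (σ x)) (h : FirstDescent σ dir x g) : r x g := by
  induction h with
  | here => exact r.refl _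
  | level _ _ ih => exact r.trans (hr _) ih
  | ascend _ _ _ ih₁ ih₂ => exact r.trans (hr _) (r.trans ih₁ (r.trans (hr _) ih₂))

variable {h : E → ℚ}

theorem pow_apply_bridge (σ : Perm E) (l i : ℕ) (x : E) :
    (σ ^ l) (σ ((σ ^ i) (σ x))) = (σ ^ (l + (i + 2))) x := by
  rw [pow_add, pow_succ, pow_succ']
  rfl

/-- The path up to `g` never goes below its starting height: in the `ascend` case the inner
excursion stays one unit higher, and its closing dart brings the path back to the height of `x`. -/
theorem spec (hh : ∀ x, h (σ x) = h x - (dir x : ℚ)) (H : FirstDescent σ dir x g) :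
    ∃ i : ℕ, g = (σ ^ i) x ∧ h g = h x ∧ ∀ j ≤ i, h x ≤ h ((σ ^ j) x) := by
  induction H with
  | here _ => exact ⟨0, by simp⟩
  | @level x g h0 _ ih =>
    obtain ⟨i, rfl, h1, h2⟩ := ih
    have hx : h (σ x) = h x := by simp [hh, h0]
    refine ⟨i + 1, by simp [pow_succ], by rw [h1, hx], fun j hj => ?_⟩
    rcases j with _ | j
    · simp
    · have := h2 j (by omega)
      rw [hx] at this
      simpa [pow_succ] using this
  | @ascend x b g h0 hb _ ih₁ ih₂ =>
    obtain ⟨i, rfl, h1, h2⟩ := ih₁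
    obtain ⟨k, rfl, h3, h4⟩ := ih₂
    have hx : h (σ x) = h x + 1 := by simp [hh, h0]
    have hb' : h (σ ((σ ^ i) (σ x))) = h x := by
      rw [hh, h1, hx, hb.dir_eq_one]; simp
    rw [hb'] at h3 h4
    refine ⟨k + (i + 2), pow_apply_bridge σ k i x, h3, fun j hj => ?_⟩
    rcases j with _ | j
    · simp
    · by_cases hji : j ≤ i
      · have := h2 j hji
        rw [hx] at this
        simp only [pow_succ, Perm.mul_apply]
        linarith
      · obtain ⟨l, rfl⟩ : ∃ l, j = l + (i + 1) := ⟨j - (i + 1), by omega⟩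
        have := h4 l (by omega)
        rwa [pow_apply_bridge] at this

/-- A discrete intermediate value argument: heights fall by at most one per step, so a path ending
lower than it starts has a first step below its initial height. An opening dart is handled by two
recursive calls, one for its partner and one for what follows. -/
theorem exists_of_lt (hh : ∀ x, h (σ x) = h x - (dir x : ℚ)) (n : ℕ) :
    ∀ x, h ((σ ^ n) x) < h x → ∃ i < n, FirstDescent σ dir x ((σ ^ i) x) := by
  induction n using Nat.strong_induction_on with
  | _ n ih =>
    intro x hx
    rcases n with _ | n
    · simp at hx
    rcases SignType.trichotomy (dir x) with h0 | h0 | h0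
    · have hx1 : h (σ x) = h x + 1 := by simp [hh, h0]
      obtain ⟨i, hi, H⟩ := ih n (by omega) (σ x) (by
        simp only [pow_succ, Perm.mul_apply] at hx; linarith)
      obtain ⟨-, -, h1, -⟩ := H.spec hh
      have h2 : h (σ ((σ ^ i) (σ x))) = h x := by
        rw [hh, h1, hx1, H.dir_eq_one]; simp
      obtain ⟨l, rfl⟩ : ∃ l, n = l + (i + 1) := ⟨n - (i + 1), by omega⟩
      obtain ⟨k, hk, K⟩ := ih l (by omega) (σ ((σ ^ i) (σ x))) (by rw [h2, pow_apply_bridge]; exact hx)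
      rw [pow_apply_bridge] at K
      exact ⟨_, by omega, ascend h0 H K⟩
    · obtain ⟨i, hi, H⟩ := ih n (by omega) (σ x) (by
        simpa [pow_succ, hh, h0] using hx)
      exact ⟨i + 1, by omega, level h0 (by simpa [pow_succ] using H)⟩
    · exact ⟨0, by omega, here h0⟩

end FirstDescent

/-! ### Rotation and link permutations determine each other -/

/-- The permutations `σ` and `κ` differ by the matching `θ` of parentheses: for `dir x = 1`, the
dart `θ x` closes the parenthesis opened by `α x`. -/
structure IsMatched {E : Type} (α κ σ θ : Perm E) (dir : E → SignType) : Prop where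
  apply_eq : ∀ x, κ x = σ (θ x)
  fixed : ∀ x, dir x ≠ 1 → θ x = x
  descent : ∀ x, dir x = 1 → FirstDescent σ dir (σ (α x)) (θ x)

/-- The involution `α` reverses the directions `dir`. -/
structure Reverses {E : Type} (α : Perm E) (dir : E → SignType) : Prop where
  invol : ∀ x, α (α x) = x
  dir_apply : ∀ x, dir (α x) = - dir x

namespace IsMatched

variable {E : Type} {α κ σ θ : Perm E} {dir : E → SignType} {x g b : E}

theorem apply_of_ne (H : IsMatched α κ σ θ dir) (hx : dir x ≠ 1) : κ x = σ x := by
  rw [H.apply_eq, H.fixed x hx]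

theorem descent_opening (R : Reverses α dir) (H : IsMatched α κ σ θ dir) (hx : dir x = -1) :
    FirstDescent σ dir (σ x) (θ (α x)) := by
  simpa [R.invol] using H.descent (α x) (by simp [R.dir_apply, hx])

/-- Jumping over a matched pair is a single application of `κ ∘ α`. Descents can thus be followed
using `κ` and `α` alone, without evaluating `σ` at closing darts. -/
theorem ascend_apply (R : Reverses α dir) (H : IsMatched α κ σ θ dir) (hx : dir x = -1)
    (hb : FirstDescent σ dir (σ x) b) : σ b = κ (α x) := by
  rw [hb.unique (H.descent_opening R hx), H.apply_eq]

/-- `κ` is determined by `σ`, equivariantly. -/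
theorem equivariant_right {E' : Type} {α' κ' σ' θ' : Perm E'} {dir' : E' → SignType}
    (H : IsMatched α κ σ θ dir) (H' : IsMatched α' κ' σ' θ' dir') (k : E ≃ E')
    (hα : ∀ x, k (α x) = α' (k x)) (hd : ∀ x, dir' (k x) = dir x)
    (hσ : ∀ x, k (σ x) = σ' (k x)) (x : E) : k (κ x) = κ' (k x) := by
  have key : ∀ {x g}, FirstDescent σ dir x g → FirstDescent σ' dir' (k x) (k g) := by
    intro x g h
    induction h with
    | here h => exact .here (by rw [hd, h])
    | level h _ ih => exact .level (by rw [hd, h]) (hσ _ ▸ ih)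
    | ascend h _ _ ih₁ ih₂ => exact .ascend (by rw [hd, h]) (hσ _ ▸ ih₁) (hσ _ ▸ ih₂)
  by_cases hx : dir x = 1
  · have h1 := key (H.descent x hx)
    rw [hσ, hα] at h1
    rw [H.apply_eq, H'.apply_eq, hσ, h1.unique (H'.descent (k x) (by rw [hd, hx]))]
  · rw [H.apply_of_ne hx, hσ, H'.apply_of_ne (by rwa [hd])]

theorem dir_theta_symm (H : IsMatched α κ σ θ dir) (hx : dir x = 1) :
    dir (θ.symm x) = 1 := by
  by_contra h
  have := H.fixed _ h
  rw [Equiv.apply_symm_apply] at this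
  exact h (this ▸ hx)

/-- `σ` is determined by `κ`, equivariantly. -/
theorem equivariant_left {E' : Type} {α' κ' σ' θ' : Perm E'} {dir' : E' → SignType}
    (R : Reverses α dir) (R' : Reverses α' dir')
    (H : IsMatched α κ σ θ dir) (H' : IsMatched α' κ' σ' θ' dir') (k : E ≃ E')
    (hα : ∀ x, k (α x) = α' (k x)) (hd : ∀ x, dir' (k x) = dir x)
    (hκ : ∀ x, k (κ x) = κ' (k x)) (x : E) : k (σ x) = σ' (k x) := by
  have hne : ∀ x, dir x ≠ 1 → k (σ x) = σ' (k x) := by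
    intro x hx
    rw [← H.apply_of_ne hx, hκ, H'.apply_of_ne (by rwa [hd])]
  -- Equivariance of `σ` is known so far only off the closing darts. This suffices: a descent
  -- applies `σ` to a closing dart only after a matched pair, where `ascend_apply` replaces it by `κ
  -- ∘ α`.
  have key : ∀ {x g}, FirstDescent σ dir x g → FirstDescent σ' dir' (k x) (k g) := by
    intro x g h
    induction h with
    | here h => exact .here (by rw [hd, h])
    | level h _ ih => exact .level (by rw [hd, h]) (by rwa [hne _ (by simp [h])] at ih)
    | @ascend x b g h hb _ ih₁ ih₂ =>
      rw [hne _ (by simp [h])] at ih₁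
      have hx : dir' (k x) = -1 := by rw [hd, h]
      refine .ascend hx ih₁ ?_
      rw [H'.ascend_apply R' hx ih₁, ← hα, ← hκ, ← H.ascend_apply R h hb]
      exact ih₂
  by_cases hx : dir x = 1
  · have h2 := H.dir_theta_symm hx
    set y := θ.symm x with hy
    have hxy : x = θ y := by simp [hy]
    have h1 := key (H.descent y h2)
    rw [hne _ (by simp [R.dir_apply, h2]), hα] at h1
    rw [hxy, ← H.apply_eq, hκ, H'.apply_eq, h1.unique (H'.descent (k y) (by rw [hd, h2]))]
  · exact hne x hx

end IsMatched

/-! ### Balanced cyclic words and height functions -/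

section Balanced

open Finset

variable {E : Type} [Fintype E] {σ : Perm E}

open Classical in
theorem card_eq_iff_sum_dir_eq_zero (dir : E → SignType) (p : E → Prop) :
    Nat.card {d // p d ∧ dir d = 1} = Nat.card {d // p d ∧ dir d = -1} ↔
      ∑ d with p d, (dir d : ℚ) = 0 := by
  have key : ∀ d, (dir d : ℚ) = (if dir d = 1 then 1 else 0) - (if dir d = -1 then 1 else 0) := by
    intro d
    rcases SignType.trichotomy (dir d) with h | h | h <;> simp [h]
  rw [sum_congr rfl fun d _ => key d, sum_sub_distrib, sum_boole, sum_boole, sub_eq_zero,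
    filter_filter, filter_filter, Nat.card_eq_fintype_card, Nat.card_eq_fintype_card,
    Fintype.card_subtype, Fintype.card_subtype, Nat.cast_inj]

open Classical in
/-- A function whose sum over each cycle vanishes has vanishing sum along a full period. -/
theorem sum_range_pow_eq_zero {N : ℕ} (hN : σ ^ N = 1) (f : E → ℚ)
    (hf : ∀ v : PermCycles σ, ∑ d with (Quotient.mk _ d : PermCycles σ) = v, f d = 0) (x : E) :
    ∑ i ∈ range N, f ((σ ^ i) x) = 0 := by
  set T : E → ℚ := fun x => ∑ i ∈ range N, f ((σ ^ i) x) with hT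
  -- `T` is constant on the cycle of `x`, while its sum over that cycle is a sum of `N` vanishing
  -- sums; hence the constant is zero.
  have hinv : ∀ x, T (σ x) = T x := by
    intro x
    have h1 : T (σ x) = ∑ i ∈ range N, f ((σ ^ (i + 1)) x) := by
      simp [hT, pow_succ]
    have h2 := sum_range_succ' (fun i => f ((σ ^ i) x)) N
    rw [sum_range_succ, hN] at h2
    rw [h1]
    simp only [pow_zero, Perm.coe_one, id] at h2
    simp only [hT]
    linarith
  have hcyc : ∀ y, σ.SameCycle x y → T y = T x := by
    rintro y ⟨i, rfl⟩
    induction i using Int.induction_on with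
    | zero => simp
    | succ i ih => rw [add_comm, zpow_add, zpow_one, Perm.mul_apply, hinv, ih]
    | pred i ih =>
      rw [← ih, ← hinv]
      congr 1
      rw [← Perm.mul_apply, ← zpow_one_add]
      congr 2
      ring
  set v : PermCycles σ := Quotient.mk _ x
  have hmem : ∀ d, (Quotient.mk _ d : PermCycles σ) = v ↔ σ.SameCycle d x :=
    fun d => Quotient.eq
  have hsum : ∑ d with (Quotient.mk _ d : PermCycles σ) = v, T d = 0 := by
    simp only [hT]
    rw [sum_comm]
    refine sum_eq_zero fun i _ => ?_
    rw [← hf v]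
    refine sum_bij (fun d _ => (σ ^ i) d) ?_ ?_ ?_ ?_
    · intro d hd
      simp only [mem_filter, mem_univ, true_and, hmem] at hd ⊢
      rwa [Perm.sameCycle_pow_left]
    · intro a _ b _ h
      exact (σ ^ i).injective h
    · intro b hb
      refine ⟨(σ ^ i).symm b, ?_, by simp⟩
      simp only [mem_filter, mem_univ, true_and, hmem] at hb ⊢
      rwa [← Perm.sameCycle_pow_left (n := i), Equiv.apply_symm_apply]
    · intro _ _
      rfl
  rw [sum_congr rfl (g := fun _ => T x)
    (fun d hd => hcyc d (((hmem d).1 (mem_filter.1 hd).2).symm)), sum_const, nsmul_eq_mul] at hsum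
  refine (mul_eq_zero.1 hsum).resolve_left ?_
  refine Nat.cast_ne_zero.2 ?_
  exact card_ne_zero_of_mem (a := x) (by simp [v])

open Classical in
/-- A balanced direction function on a cycle is the derivative of a height function. -/
theorem exists_height_of_balanced (f : E → ℚ)
    (hf : ∀ v : PermCycles σ, ∑ d with (Quotient.mk _ d : PermCycles σ) = v, f d = 0) :
    ∃ h : E → ℚ, ∀ x, h (σ x) = h x - f x := by
  obtain ⟨n, hn⟩ : ∃ n, orderOf σ = n + 1 := Nat.exists_eq_add_one.2 (orderOf_pos σ)
  have hN : σ ^ (n + 1) = 1 := hn ▸ pow_orderOf_eq_one σ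
  set S : E → ℕ → ℚ := fun x j => ∑ i ∈ range j, f ((σ ^ i) x) with hS
  have hSN : ∀ x, S x (n + 1) = 0 := sum_range_pow_eq_zero hN f hf
  have hSs : ∀ x j, S x (j + 1) = f x + S (σ x) j := by
    intro x j
    simp only [hS, sum_range_succ', pow_succ, Perm.mul_apply]
    simp [add_comm]
  have hne : (range (n + 1)).Nonempty := ⟨0, by simp⟩
  -- The height of `x` is the largest partial sum of `f` read from `x` over one period. As the sum
  -- over a full period is zero, the window of lengths wraps around, and moving to `σ x` lowers the
  -- maximum by exactly `f x`.
  refine ⟨fun x => (range (n + 1)).sup' hne (S x), fun x => ?_⟩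
  apply le_antisymm
  · refine sup'_le _ _ fun j hj => ?_
    rw [le_sub_iff_add_le, add_comm, ← hSs]
    rcases Nat.lt_or_ge (j + 1) (n + 1) with h | h
    · exact le_sup' (S x) (mem_range.2 h)
    · obtain rfl : j = n := by have := mem_range.1 hj; omega
      rw [hSN]
      exact le_sup' (S x) (mem_range.2 (Nat.succ_pos _))
  · rw [sub_le_iff_le_add]
    refine sup'_le _ _ fun j hj => ?_
    rw [add_comm]
    rcases j with _ | j
    · have h0 : S x 0 = f x + S (σ x) n := by rw [← hSs, hSN]; simp [hS]
      rw [h0]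
      gcongr
      exact le_sup' (S (σ x)) (mem_range.2 (Nat.lt_succ_self _))
    · rw [hSs]
      gcongr
      exact le_sup' (S (σ x)) (mem_range.2 (by have := mem_range.1 hj; omega))

open Classical in
theorem sum_cycle_eq_zero_of_height {f h : E → ℚ} (hh : ∀ x, h (σ x) = h x - f x)
    (v : PermCycles σ) : ∑ d with (Quotient.mk _ d : PermCycles σ) = v, f d = 0 := by
  have hf : ∀ x, f x = h x - h (σ x) := fun x => by rw [hh]; ring
  rw [sum_congr rfl fun d _ => hf d, sum_sub_distrib, sub_eq_zero]
  have hmem : ∀ d, (Quotient.mk _ (σ d) : PermCycles σ) = Quotient.mk _ d :=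
    fun d => Quotient.sound (Perm.sameCycle_apply_left.2 (Perm.SameCycle.refl _ _))
  symm
  refine sum_bij (fun d _ => σ d) ?_ (fun a _ b _ h => σ.injective h) ?_ (fun _ _ => rfl)
  · intro d hd
    simp only [mem_filter, mem_univ, true_and] at hd ⊢
    rwa [hmem]
  · intro b hb
    refine ⟨σ.symm b, ?_, by simp⟩
    simp only [mem_filter, mem_univ, true_and] at hb ⊢
    rw [← hmem, Equiv.apply_symm_apply, hb]

end Balanced

/-! ### Existence of the matching, from either permutation -/

section Existence

variable {E : Type} {α κ σ : Perm E} {dir : E → SignType} {h : E → ℚ}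

/-- Both openings have the same height. If one path to `g` were longer, the opening of the shorter
one would lie on it, one unit below the level that the longer path never leaves. -/
theorem FirstDescent.opening_unique (hh : ∀ x, h (σ x) = h x - (dir x : ℚ)) {m m' g : E}
    (hm : dir m = -1) (hm' : dir m' = -1)
    (H : FirstDescent σ dir (σ m) g) (H' : FirstDescent σ dir (σ m') g) : m = m' := by
  obtain ⟨i, hi, e, k⟩ := H.spec hh
  obtain ⟨i', hi', e', k'⟩ := H'.spec hh
  have e1 : h m = h m' := by
    rw [e, hh, hh, hm, hm'] at e'
    linarith
  have aux : ∀ {m m' : E} {i i' : ℕ}, i < i' → dir m' = -1 → h m = h m' →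
      (σ ^ i) (σ m) = (σ ^ i') (σ m') →
      (∀ j ≤ i', h (σ m') ≤ h ((σ ^ j) (σ m'))) → False := by
    intro m m' i i' hlt hm' e1 e2 k'
    obtain ⟨l, rfl⟩ : ∃ l, i' = (i + 1) + l := ⟨i' - (i + 1), by omega⟩
    rw [pow_add, Perm.mul_apply, pow_succ, Perm.mul_apply] at e2
    have e3 := σ.injective ((σ ^ i).injective e2)
    have := k' l (by omega)
    rw [← e3, hh, hm'] at this
    simp at this
    linarith
  rcases lt_trichotomy i i' with hlt | heq | hgt
  · exact (aux hlt hm' e1 (hi.symm.trans hi') k').elim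
  · subst heq
    exact σ.injective ((σ ^ i).injective (hi.symm.trans hi'))
  · exact (aux hgt hm e1.symm (hi'.symm.trans hi) k).elim

variable [Finite E]

theorem exists_isMatched_of_rot (R : Reverses α dir) (hh : ∀ x, h (σ x) = h x - (dir x : ℚ)) :
    ∃ κ θ : Perm E, IsMatched α κ σ θ dir := by
  classical
  have hex : ∀ x, ∃ g, (dir x ≠ 1 → g = x) ∧ (dir x = 1 → FirstDescent σ dir (σ (α x)) g) := by
    intro x
    by_cases hx : dir x = 1
    -- Going round from `σ (α x)` back to the opening dart `α x` lowers the height by one, so a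
    -- descent occurs on the way.
    · obtain ⟨n, hn⟩ : ∃ n, orderOf σ = n + 1 := Nat.exists_eq_add_one.2 (orderOf_pos σ)
      have hN : (σ ^ n) (σ (α x)) = α x := by
        rw [← Perm.mul_apply, ← pow_succ, ← hn, pow_orderOf_eq_one, Perm.one_apply]
      obtain ⟨i, -, H⟩ := FirstDescent.exists_of_lt hh n (σ (α x)) (by
        rw [hN, hh, R.dir_apply, hx]; simp)
      exact ⟨_, fun h => (h hx).elim, fun _ => H⟩
    · exact ⟨x, fun _ => rfl, fun h => (hx h).elim⟩
  choose t ht1 ht2 using hex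
  have hinj : Function.Injective t := by
    intro x y hxy
    by_cases hx : dir x = 1 <;> by_cases hy : dir y = 1
    · have := ht2 y hy
      rw [← hxy] at this
      exact α.injective (FirstDescent.opening_unique hh (by simp [R.dir_apply, hx])
        (by simp [R.dir_apply, hy]) (ht2 x hx) this)
    · exact (hy (by rw [← ht1 y hy, ← hxy]; exact (ht2 x hx).dir_eq_one)).elim
    · exact (hx (by rw [← ht1 x hx, hxy]; exact (ht2 y hy).dir_eq_one)).elim
    · rw [← ht1 x hx, hxy, ht1 y hy]
  let θ : Perm E := Equiv.ofBijective t (Finite.injective_iff_bijective.1 hinj)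
  exact ⟨σ * θ, θ, fun _ => rfl, ht1, ht2⟩

/-- In the word to be built, `ν = κ * τ` moves at constant height: it steps past a level dart, jumps
over the matched pair of an opening dart, and from a closing dart `x` restarts just after the
opening dart `α x`. So `θ` must be the first-return map of `ν` to the closing darts, and `σ = κ *
θ⁻¹`. -/
theorem exists_isMatched_of_link (R : Reverses α dir)
    (hκ : ∀ x, h (κ x) = h x - (dir x : ℚ)) (hα : ∀ x, h (α x) = h x - (dir x : ℚ)) :
    ∃ σ θ : Perm E, IsMatched α κ σ θ dir ∧ ∀ x, h (σ x) = h x - (dir x : ℚ) := by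
  classical
  let τ : Perm E := Function.Involutive.toPerm (fun x => if dir x = 0 then x else α x) (by
    intro x
    by_cases hx : dir x = 0 <;> simp [hx, R.dir_apply, R.invol])
  have hτ0 : ∀ x, dir x = 0 → τ x = x := fun x hx => if_pos hx
  have hτ1 : ∀ x, dir x ≠ 0 → τ x = α x := fun x hx => if_neg hx
  let ν : Perm E := κ * τ
  have hν0 : ∀ x, dir x = 0 → ν x = κ x := fun x hx => congrArg κ (hτ0 x hx)
  have hν1 : ∀ x, dir x ≠ 0 → ν x = κ (α x) := fun x hx => congrArg κ (hτ1 x hx)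
  have hνh : ∀ x, h (ν x) = h x := by
    intro x
    by_cases hx : dir x = 0
    · simp [hν0 x hx, hκ, hx]
    · simp [hν1 x hx, hκ, hα, R.dir_apply]
  obtain ⟨n, hn⟩ : ∃ n, orderOf ν = n + 1 := Nat.exists_eq_add_one.2 (orderOf_pos ν)
  have hN : ν ^ (n + 1) = 1 := hn ▸ pow_orderOf_eq_one ν
  have hret : ∀ x, dir x = 1 → ∃ k, dir ((ν ^ k) (ν x)) = 1 := fun x hx =>
    ⟨n, by rw [← Perm.mul_apply, ← pow_succ, hN]; exact hx⟩
  have hex : ∀ x, ∃ g, (dir x ≠ 1 → g = x) ∧ (dir x = 1 → ∃ k, g = (ν ^ k) (ν x) ∧ dir g = 1 ∧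
      ∀ j < k, dir ((ν ^ j) (ν x)) ≠ 1) := by
    intro x
    by_cases hx : dir x = 1
    · exact ⟨_, fun h => (h hx).elim, fun _ => ⟨Nat.find (hret x hx), rfl,
        Nat.find_spec (hret x hx), fun j hj => Nat.find_min (hret x hx) hj⟩⟩
    · exact ⟨x, fun _ => rfl, fun h => (hx h).elim⟩
  choose t ht1 ht2 using hex
  have aux : ∀ {x y : E} {i j : ℕ}, i < j → dir x = 1 → (ν ^ i) (ν x) = (ν ^ j) (ν y) →
      (∀ l < j, dir ((ν ^ l) (ν y)) ≠ 1) → False := by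
    intro x y i j hlt hx e hj
    obtain ⟨l, rfl⟩ : ∃ l, j = (i + 1) + l := ⟨j - (i + 1), by omega⟩
    rw [pow_add, Perm.mul_apply, pow_succ, Perm.mul_apply] at e
    have e3 := ν.injective ((ν ^ i).injective e)
    exact hj l (by omega) (e3 ▸ hx)
  have hinj : Function.Injective t := by
    intro x y hxy
    by_cases hx : dir x = 1 <;> by_cases hy : dir y = 1
    · obtain ⟨i, hi, -, hi'⟩ := ht2 x hx
      obtain ⟨j, hj, -, hj'⟩ := ht2 y hy
      have e : (ν ^ i) (ν x) = (ν ^ j) (ν y) := by rw [← hi, ← hj, hxy]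
      rcases lt_trichotomy i j with hlt | heq | hgt
      · exact (aux hlt hx e hj').elim
      · subst heq
        exact ν.injective ((ν ^ i).injective e)
      · exact (aux hgt hy e.symm hi').elim
    · obtain ⟨i, -, hi, -⟩ := ht2 x hx
      exact (hy (by rwa [← ht1 y hy, ← hxy])).elim
    · obtain ⟨i, -, hi, -⟩ := ht2 y hy
      exact (hx (by rwa [← ht1 x hx, hxy])).elim
    · rw [← ht1 x hx, hxy, ht1 y hy]
  let θ : Perm E := Equiv.ofBijective t (Finite.injective_iff_bijective.1 hinj)
  have hpow : ∀ k x, h ((ν ^ k) x) = h x := by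
    intro k
    induction k with
    | zero => simp
    | succ k ih => intro x; rw [pow_succ, Perm.mul_apply, ih, hνh]
  have hθh : ∀ x, h (θ x) = h x := by
    intro x
    by_cases hx : dir x = 1
    · obtain ⟨k, hk, -⟩ := ht2 x hx
      change h (t x) = h x
      rw [hk, hpow, hνh]
    · exact congrArg h (ht1 x hx)
  let σ : Perm E := κ * θ⁻¹
  have hσθ : ∀ x, σ (θ x) = κ x := fun x => by simp [σ]
  have hσne : ∀ x, dir x ≠ 1 → σ x = κ x := by
    intro x hx
    rw [← hσθ x]
    exact congrArg σ (ht1 x hx).symm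
  have hσh : ∀ x, h (σ x) = h x - (dir x : ℚ) := by
    intro x
    obtain ⟨y, rfl⟩ := θ.surjective x
    rw [hσθ, hκ, hθh]
    by_cases hy : dir y = 1
    · obtain ⟨k, -, hk, -⟩ := ht2 y hy
      rw [hy, show dir (θ y) = 1 from hk]
    · rw [show θ y = y from ht1 y hy]
  -- Induction from the greatest heights downwards, possible because `E` is finite.
  have wf : WellFounded (fun a b : E => h b < h a) :=
    haveI : IsTrans E (fun a b : E => h b < h a) := ⟨fun _ _ _ h1 h2 => lt_trans h2 h1⟩
    haveI : Std.Irrefl (fun a b : E => h b < h a) := ⟨fun _ => lt_irrefl _⟩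
    Finite.wellFounded_of_trans_of_irrefl _
  -- Outer induction on height, inner induction on the number of `ν`-steps. At an opening dart `y`
  -- the path to its partner starts from `κ y`, one unit higher, so the outer hypothesis supplies
  -- the inner excursion.
  have key : ∀ x, ∀ k y, h y = h x → (∀ j < k, dir ((ν ^ j) y) ≠ 1) → dir ((ν ^ k) y) = 1 →
      FirstDescent σ dir y ((ν ^ k) y) := by
    intro x
    induction x using wf.induction with
    | _ x ih =>
      intro k
      induction k with
      | zero => intro y _ _ hy; exact .here hy
      | succ k ihk =>
        intro y hy hlt hk
        have hy0 : dir y ≠ 1 := hlt 0 (Nat.succ_pos k)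
        have hstep := ihk (ν y) (by rw [hνh, hy])
          (fun j hj => by simpa [pow_succ] using hlt (j + 1) (by omega))
          (by simpa [pow_succ] using hk)
        rw [pow_succ, Perm.mul_apply]
        rcases SignType.trichotomy (dir y) with hd | hd | hd
        · have hd' : dir (α y) = 1 := by simp [R.dir_apply, hd]
          obtain ⟨l, hl, hl1, hl2⟩ := ht2 (α y) hd'
          have hνα : ν (α y) = κ y := by rw [hν1 _ (by simp [hd']), R.invol]
          have h1 := ih (κ y) (by rw [hκ, hd, hy]; simp) l (κ y) rfl
            (by rwa [hνα] at hl2) (by rw [← hνα, ← hl]; exact hl1)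
          rw [← hνα, ← hl, hνα, ← hσne y hy0] at h1
          refine .ascend hd h1 ?_
          rw [show σ (t (α y)) = κ (α y) from hσθ (α y), ← hν1 y (by simp [hd])]
          exact hstep
        · refine .level hd ?_
          rw [hσne y hy0, ← hν0 y hd]
          exact hstep
        · exact (hy0 hd).elim
  refine ⟨σ, θ, ⟨fun x => (hσθ x).symm, ht1, fun x hx => ?_⟩, hσh⟩
  obtain ⟨k, hk, hk1, hk2⟩ := ht2 x hx
  have hνx : ν x = σ (α x) := by
    rw [hν1 x (by simp [hx]), hσne _ (by simp [R.dir_apply, hx])]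
  rw [show θ x = (ν ^ k) (ν x) from hk, ← hνx]
  exact key (ν x) k (ν x) rfl hk2 (hk ▸ hk1)

end Existence

/-! ### Cycles, transitivity and fixed-point-free involutions -/

theorem Equiv.Perm.SameCycle.rel {A : Type} {p : Perm A} (r : Setoid A) (hr : ∀ x, r x (p x))
    {x y : A} (h : p.SameCycle x y) : r x y := by
  obtain ⟨i, rfl⟩ := h
  induction i using Int.induction_on with
  | zero => exact r.refl _
  | succ i ih =>
    rw [add_comm, zpow_add, zpow_one, Perm.mul_apply]
    exact r.trans ih (hr _)
  | pred i ih =>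
    refine r.trans ih (r.symm ?_)
    convert hr _ using 1
    rw [← Perm.mul_apply, ← zpow_one_add]
    congr 2
    ring

/-- Transitivity of the group generated by two permutations, in terms of equivalence relations. -/
theorem transitive_closure_pair_iff {D : Type} (p q : Perm D) :
    (∀ x y : D, ∃ g ∈ Subgroup.closure ({p, q} : Set (Perm D)), g x = y) ↔
      ∀ r : Setoid D, (∀ x, r x (p x)) → (∀ x, r x (q x)) → ∀ x y, r x y := by
  constructor
  · intro H r hp hq x y
    obtain ⟨g, hg, rfl⟩ := H x y
    induction hg using Subgroup.closure_induction generalizing x with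
    | mem g hg =>
      rcases hg with rfl | rfl
      · exact hp x
      · exact hq x
    | one => exact r.refl _
    | mul a b _ _ iha ihb => exact r.trans (ihb x) (iha (b x))
    | inv a _ ih => simpa using r.symm (ih (a⁻¹ x))
  · intro H
    refine H ⟨fun x y => ∃ g ∈ Subgroup.closure ({p, q} : Set (Perm D)), g x = y, ?_, ?_, ?_⟩ ?_ ?_
    · exact fun x => ⟨1, one_mem _, rfl⟩
    · rintro x y ⟨g, hg, rfl⟩
      exact ⟨g⁻¹, inv_mem hg, by simp⟩
    · rintro x y z ⟨g, hg, rfl⟩ ⟨k, hk, rfl⟩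
      exact ⟨k * g, mul_mem hk hg, rfl⟩
    · exact fun x => ⟨p, Subgroup.subset_closure (by simp), rfl⟩
    · exact fun x => ⟨q, Subgroup.subset_closure (by simp), rfl⟩

section Involution

variable {E : Type} {α : Perm E}

theorem sameCycle_iff_of_involutive (hα : ∀ x, α (α x) = x) (x y : E) :
    α.SameCycle x y ↔ y = x ∨ y = α x := by
  constructor
  · intro h
    refine h.rel ⟨fun x y => y = x ∨ y = α x, fun x => Or.inl rfl, ?_, ?_⟩ (fun x => Or.inr rfl)
    · rintro x y (rfl | rfl)
      · exact Or.inl rfl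
      · exact Or.inr (hα x).symm
    · rintro x y z (rfl | rfl) (rfl | rfl) <;> simp [hα]
  · rintro (rfl | rfl)
    · exact Perm.SameCycle.refl _ _
    · exact Perm.sameCycle_apply_right.2 (Perm.SameCycle.refl _ _)

theorem card_cycle_of_involutive (hα : ∀ x, α (α x) = x) (hne : ∀ x, α x ≠ x)
    (e : PermCycles α) : Nat.card {x // (Quotient.mk _ x : PermCycles α) = e} = 2 := by
  induction e using Quotient.inductionOn with
  | h y =>
    have : {x | (Quotient.mk _ x : PermCycles α) = Quotient.mk _ y} = {y, α y} := by
      ext x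
      simp only [Set.mem_ofPred_eq, Set.mem_insert_iff, Set.mem_singleton_iff]
      rw [eq_comm, Quotient.eq]
      exact sameCycle_iff_of_involutive hα y x
    change Nat.card ({x | (Quotient.mk _ x : PermCycles α) = Quotient.mk _ y} : Set E) = 2
    rw [this, Nat.card_coe_set_eq, Set.ncard_pair (hne y).symm]

theorem card_eq_two_mul_of_involutive [Finite E] (hα : ∀ x, α (α x) = x) (hne : ∀ x, α x ≠ x) :
    Nat.card E = 2 * Nat.card (PermCycles α) := by
  have := Fintype.ofFinite (Quotient (Perm.SameCycle.setoid α))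
  rw [← Nat.card_congr (Equiv.sigmaFiberEquiv (fun x : E => (Quotient.mk _ x : PermCycles α))),
    Nat.card_sigma]
  simp [card_cycle_of_involutive hα hne, mul_comm]

end Involution

/-! ### The quartic vertex attached to an edge -/

section LocalStructure

variable {E : Type} {α : Perm E} {dir : E → SignType}

/-- The rotation of a quartic orientation. Its outgoing darts are `Sum.inl e`, its incoming
darts `Sum.inr e`; the outgoing darts at a vertex are exchanged by `α`. A vertex with out-darts
`a` and `b = α a` reads `a, b, a', b'` if `dir a = 1`, and `a, a', b, b'` if `dir a = 0`. -/
def localRot (R : Reverses α dir) : Perm (E ⊕ E) where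
  toFun := Sum.elim
    (fun m => if dir m = 1 then .inl (α m) else if dir m = 0 then .inr m else .inr (α m))
    (fun m => if dir m = 1 then .inr (α m) else .inl (α m))
  invFun := Sum.elim
    (fun m => if dir m = -1 then .inl (α m) else .inr (α m))
    (fun m => if dir m = -1 then .inr (α m) else if dir m = 0 then .inl m else .inl (α m))
  left_inv := by
    rintro (m | m) <;> rcases SignType.trichotomy (dir m) with h | h | h <;>
      simp [h, R.dir_apply, R.invol]
  right_inv := by
    rintro (m | m) <;> rcases SignType.trichotomy (dir m) with h | h | h <;>
      simp [h, R.dir_apply, R.invol]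

/-- The involution of the darts for which `Sum.inr m` and `Sum.inl (κ m)` form an edge. -/
def linkOpp (κ : Perm E) : Perm (E ⊕ E) where
  toFun := Sum.elim (fun e => .inr (κ.symm e)) (fun m => .inl (κ m))
  invFun := Sum.elim (fun e => .inr (κ.symm e)) (fun m => .inl (κ m))
  left_inv := by rintro (m | m) <;> simp
  right_inv := by rintro (m | m) <;> simp

@[simp] theorem linkOpp_inl (κ : Perm E) (e : E) :
    linkOpp κ (.inl e) = .inr (κ.symm e) := rfl

@[simp] theorem linkOpp_inr (κ : Perm E) (e : E) : linkOpp κ (.inr e) = .inl (κ e) := rfl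

theorem linkOpp_linkOpp (κ : Perm E) (d : E ⊕ E) : linkOpp κ (linkOpp κ d) = d := by
  rcases d with e | e <;> simp

theorem linkOpp_ne (κ : Perm E) (d : E ⊕ E) : linkOpp κ d ≠ d := by
  rcases d with e | e <;> simp

variable (R : Reverses α dir) {m : E}

theorem localRot_inl_of_one (h : dir m = 1) : localRot R (.inl m) = .inl (α m) := by
  simp [localRot, h]

theorem localRot_inl_of_zero (h : dir m = 0) : localRot R (.inl m) = .inr m := by
  simp [localRot, h]

theorem localRot_inl_of_neg (h : dir m = -1) : localRot R (.inl m) = .inr (α m) := by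
  simp [localRot, h]

theorem localRot_inr_of_one (h : dir m = 1) : localRot R (.inr m) = .inr (α m) := by
  simp [localRot, h]

theorem localRot_inr_of_ne (h : dir m ≠ 1) : localRot R (.inr m) = .inl (α m) := by
  simp [localRot, h]

/-- The out-dart associated with a dart at the same vertex. -/
def baseDart (d : E ⊕ E) : E := Sum.elim id id d

theorem baseDart_localRot (d : E ⊕ E) :
    baseDart (localRot R d) = baseDart d ∨ baseDart (localRot R d) = α (baseDart d) := by
  rcases d with m | m <;> rcases SignType.trichotomy (dir m) with h | h | h <;>
    simp [localRot, h, baseDart]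

theorem sameCycle_localRot_inl (m : E) :
    (localRot R).SameCycle (.inl m) (.inl (α m)) ∧ (localRot R).SameCycle (.inl m) (.inr m) := by
  have step : ∀ {a b : E ⊕ E}, localRot R a = b → (localRot R).SameCycle a b := by
    rintro a b rfl
    exact Perm.sameCycle_apply_right.2 (Perm.SameCycle.refl _ _)
  have key : ∀ m, dir m = 1 → (localRot R).SameCycle (.inl m) (.inl (α m)) ∧
      (localRot R).SameCycle (.inl m) (.inr m) ∧ (localRot R).SameCycle (.inr m) (.inr (α m)) := by
    intro m h
    have h' : dir (α m) = -1 := by simp [R.dir_apply, h]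
    have h1 := step (localRot_inl_of_one R h)
    have h2 := step (localRot_inl_of_neg R h')
    rw [R.invol] at h2
    exact ⟨h1, h1.trans h2, step (localRot_inr_of_one R h)⟩
  rcases SignType.trichotomy (dir m) with h | h | h
  · obtain ⟨h1, h2, h3⟩ := key (α m) (by simp [R.dir_apply, h])
    rw [R.invol] at h1 h3
    exact ⟨h1.symm, h1.symm.trans (h2.trans h3)⟩
  · have h1 := step (localRot_inl_of_zero R h)
    have h2 := step (localRot_inr_of_ne R (m := m) (by simp [h]))
    exact ⟨h1.trans h2, h1⟩
  · exact ⟨(key m h).1, (key m h).2.1⟩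

/-- One rotation step changes the base dart at most by `α`, and conversely the four darts over an
edge are connected by rotation; so each edge carries exactly one quartic vertex. -/
theorem sameCycle_localRot_iff (a b : E ⊕ E) :
    (localRot R).SameCycle a b ↔ α.SameCycle (baseDart a) (baseDart b) := by
  constructor
  · intro h
    refine h.rel ((Perm.SameCycle.setoid α).comap baseDart) (fun x => ?_)
    change α.SameCycle _ _
    rw [sameCycle_iff_of_involutive R.invol]
    exact baseDart_localRot R x
  · have hb : ∀ d : E ⊕ E, (localRot R).SameCycle d (.inl (baseDart d)) := by
      rintro (m | m)
      · exact Perm.SameCycle.refl _ _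
      · exact (sameCycle_localRot_inl R m).2.symm
    intro h
    refine (hb a).trans (Perm.SameCycle.trans ?_ (hb b).symm)
    exact h.rel ((Perm.SameCycle.setoid (localRot R)).comap Sum.inl)
      (fun x => (sameCycle_localRot_inl R x).1)

/-- Vertices of the quartic map are edges of the partially oriented map. -/
def vertexEquivEdge : PermCycles (localRot R) ≃ PermCycles α where
  toFun := Quotient.map' baseDart fun a b h => (sameCycle_localRot_iff R a b).1 h
  invFun := Quotient.map' Sum.inl fun a b h =>
    (sameCycle_localRot_iff R (.inl a) (.inl b)).2 h
  left_inv := by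
    rintro ⟨d⟩
    exact Quotient.sound ((sameCycle_localRot_iff R _ _).2 (Perm.SameCycle.refl _ _))
  right_inv := by
    rintro ⟨d⟩
    rfl

theorem card_cycles_linkOpp [Finite E] (κ : Perm E) (hne : ∀ x, α x ≠ x)
    (hα : ∀ x, α (α x) = x) :
    Nat.card (PermCycles (linkOpp κ)) = 2 * Nat.card (PermCycles α) := by
  have h1 := card_eq_two_mul_of_involutive (linkOpp_linkOpp κ) (linkOpp_ne κ)
  have h2 := card_eq_two_mul_of_involutive hα hne
  rw [Nat.card_sum] at h1
  omega

end LocalStructure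

/-! ### Connectedness, faces and Euler's relation -/

section Matched

variable {E : Type} {α κ σ θ : Perm E} {dir : E → SignType} (R : Reverses α dir)

/-- Together with `α`, each of `σ` and `κ` generates the same equivalence relation: `κ` follows `σ`
along a descent, and conversely descents can be followed with `κ` and `α`. Over an edge all four
quartic darts are equivalent, so passing to `E ⊕ E` loses nothing. -/
theorem IsMatched.transitive_iff (H : IsMatched α κ σ θ dir) :
    (∀ x y : E, ∃ g ∈ Subgroup.closure ({σ, α} : Set (Perm E)), g x = y) ↔
    ∀ x y : E ⊕ E, ∃ g ∈ Subgroup.closure ({localRot R, linkOpp κ} : Set (Perm (E ⊕ E))),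
      g x = y := by
  rw [transitive_closure_pair_iff, transitive_closure_pair_iff]
  constructor
  · intro T r hrot hopp
    have hcyc : ∀ {a b}, (localRot R).SameCycle a b → r a b := fun h => h.rel r hrot
    let s : Setoid E := r.comap Sum.inl
    have hα : ∀ x, s x (α x) := fun x => hcyc (sameCycle_localRot_inl R x).1
    have hκ : ∀ x, s x (κ x) := fun x =>
      r.trans (hcyc (sameCycle_localRot_inl R x).2) (hopp (.inr x))
    have hW : ∀ {x g}, FirstDescent σ dir x g → s x g := by
      intro x g h
      induction h with
      | here => exact s.refl _
      | level h _ ih =>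
        rw [← H.apply_of_ne (by simp [h])] at ih
        exact s.trans (hκ _) ih
      | ascend h hb _ _ ih =>
        rw [H.ascend_apply R h hb] at ih
        exact s.trans (hα _) (s.trans (hκ _) ih)
    have hσ : ∀ x, s x (σ x) := by
      intro x
      by_cases hx : dir x = 1
      · have h2 := H.dir_theta_symm hx
        obtain ⟨y, rfl⟩ := θ.surjective x
        rw [Equiv.symm_apply_apply] at h2
        rw [← H.apply_eq]
        have h3 := hW (H.descent y h2)
        rw [← H.apply_of_ne (by simp [R.dir_apply, h2])] at h3
        -- The chain is `θ y`, `κ (α y)`, `α y`, `y`, `κ y`, the last being `σ (θ y)`.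
        exact s.trans (s.symm h3) (s.trans (s.symm (hκ _)) (s.trans (s.symm (hα _)) (hκ _)))
      · rw [← H.apply_of_ne hx]
        exact hκ x
    have hall := T s hσ hα
    have hb : ∀ d : E ⊕ E, r d (.inl (baseDart d)) := by
      rintro (m | m)
      · exact r.refl _
      · exact hcyc (sameCycle_localRot_inl R m).2.symm
    exact fun x y => r.trans (hb x) (r.trans (hall _ _) (r.symm (hb y)))
  · intro T s hσ hα
    have hκ : ∀ x, s x (κ x) := by
      intro x
      by_cases hx : dir x = 1
      · rw [H.apply_eq]
        exact s.trans (hα x) (s.trans (hσ _) (s.trans ((H.descent x hx).rel s hσ) (hσ _)))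
      · rw [H.apply_of_ne hx]
        exact hσ x
    have := T (s.comap baseDart) (fun d => by
        change s _ _
        rcases baseDart_localRot R d with h | h <;> rw [h]
        · exact hα _) (fun d => by
        change s _ _
        rcases d with e | m
        · simpa [baseDart] using s.symm (hκ (κ.symm e))
        · exact hκ m)
    exact fun x y => this (.inl x) (.inl y)

variable {h : E → ℚ}

open Classical in
/-- The cycle of `σ * α` or `σ` that corresponds to the face on the left of the edge `e`. -/
noncomputable def leftFace (α σ : Perm E) (dir : E → SignType) (e : E) :
    PermCycles (σ * α) ⊕ PermCycles σ :=
  if H : ∃ g, FirstDescent σ dir e g then .inl (Quotient.mk _ (α H.choose))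
    else .inr (Quotient.mk _ e)

theorem leftFace_of_descent {e g : E} (H : FirstDescent σ dir e g) :
    leftFace α σ dir e = .inl (Quotient.mk _ (α g)) := by
  have hex : ∃ g, FirstDescent σ dir e g := ⟨g, H⟩
  rw [leftFace, dif_pos hex, hex.choose_spec.unique H]

theorem leftFace_of_not {e : E} (H : ¬ ∃ g, FirstDescent σ dir e g) :
    leftFace α σ dir e = .inr (Quotient.mk _ e) := dif_neg H

theorem leftFace_congr {e e' : E} (hs : σ.SameCycle e e')
    (H : ∀ g, FirstDescent σ dir e g ↔ FirstDescent σ dir e' g) :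
    leftFace α σ dir e = leftFace α σ dir e' := by
  by_cases hex : ∃ g, FirstDescent σ dir e g
  · obtain ⟨g, hg⟩ := hex
    rw [leftFace_of_descent hg, leftFace_of_descent ((H g).1 hg)]
  · rw [leftFace_of_not hex, leftFace_of_not (by simpa [H] using hex), Sum.inr.injEq]
    exact Quotient.sound hs

/-- The cycle of `σ * α` or `σ` that corresponds to the face of a dart of the quartic map. -/
noncomputable def faceLabel (α κ σ : Perm E) (dir : E → SignType) :
    E ⊕ E → PermCycles (σ * α) ⊕ PermCycles σ :=
  Sum.elim (fun e => .inl (Quotient.mk _ e)) (fun m => leftFace α σ dir (κ m))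

theorem face_mk_apply (hα : ∀ x, α (α x) = x) (x : E) :
    (Quotient.mk _ (σ x) : PermCycles (σ * α)) = Quotient.mk _ (α x) := by
  refine Quotient.sound ?_
  change (σ * α).SameCycle _ _
  rw [show σ x = (σ * α) (α x) by simp [hα], Perm.sameCycle_apply_left]

theorem FirstDescent.sameCycle {x g : E} (H : FirstDescent σ dir x g) : σ.SameCycle x g :=
  H.rel (Perm.SameCycle.setoid σ)
    (fun _ => Perm.sameCycle_apply_right.2 (Perm.SameCycle.refl _ _))

/-- From an in-dart `m` the face reads the letter `e = κ m`. A level letter leads to the next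
letter, an opening one past its matched pair, and neither changes the pending descent; a closing one
leads to the out-dart `α e`, on the face of `P` named by the descent. -/
theorem faceLabel_face (H : IsMatched α κ σ θ dir) (d : E ⊕ E) :
    faceLabel α κ σ dir ((localRot R * linkOpp κ) d) = faceLabel α κ σ dir d := by
  rcases d with e | m
  · obtain ⟨m, rfl⟩ := κ.surjective e
    simp only [Perm.mul_apply, linkOpp_inl, Equiv.symm_apply_apply]
    by_cases hm : dir m = 1
    · rw [localRot_inr_of_one R hm]
      change leftFace α σ dir (κ (α m)) = .inl (Quotient.mk _ (κ m))
      rw [H.apply_of_ne (by simp [R.dir_apply, hm]), leftFace_of_descent (H.descent m hm),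
        H.apply_eq, face_mk_apply R.invol]
    · rw [localRot_inr_of_ne R hm]
      change Sum.inl (Quotient.mk _ (α m)) = Sum.inl (Quotient.mk _ (κ m))
      rw [H.apply_of_ne hm, face_mk_apply R.invol]
  · simp only [Perm.mul_apply, linkOpp_inr]
    set e := κ m with he
    rcases SignType.trichotomy (dir e) with hd | hd | hd
    · rw [localRot_inl_of_neg R hd]
      change leftFace α σ dir (κ (α e)) = leftFace α σ dir (κ m)
      rw [← he]
      have hb := H.descent_opening R hd
      rw [← H.ascend_apply R hd hb]
      refine (leftFace_congr ?_ fun g => FirstDescent.ascend_iff hd hb).symm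
      rw [Perm.sameCycle_apply_right]
      exact (Perm.sameCycle_apply_left.1 hb.sameCycle)
    · rw [localRot_inl_of_zero R hd]
      change leftFace α σ dir (κ e) = leftFace α σ dir (κ m)
      rw [← he, H.apply_of_ne (by simp [hd])]
      exact (leftFace_congr (Perm.sameCycle_apply_right.2 (Perm.SameCycle.refl _ _))
        fun g => FirstDescent.level_iff hd).symm
    · rw [localRot_inl_of_one R hd]
      change Sum.inl (Quotient.mk _ (α e)) = leftFace α σ dir (κ m)
      rw [← he, leftFace_of_descent (.here hd)]

theorem sameCycle_face_apply (κ : Perm E) {a b : E ⊕ E} (h : (localRot R * linkOpp κ) a = b) :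
    (localRot R * linkOpp κ).SameCycle a b := by
  subst h
  exact Perm.sameCycle_apply_right.2 (Perm.SameCycle.refl _ _)

theorem face_inr_of_descent (H : IsMatched α κ σ θ dir) {e g : E}
    (hg : FirstDescent σ dir e g) :
    (localRot R * linkOpp κ).SameCycle (.inr (κ.symm e)) (.inl (α g)) := by
  induction hg with
  | here h => exact sameCycle_face_apply R κ (by simp [localRot_inl_of_one R h])
  | @level x g h _ ih =>
    rw [← H.apply_of_ne (by simp [h]), Equiv.symm_apply_apply] at ih
    exact (sameCycle_face_apply R κ (by simp [localRot_inl_of_zero R h])).trans ih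
  | @ascend x b g h hb _ _ ih =>
    rw [H.ascend_apply R h hb, Equiv.symm_apply_apply] at ih
    exact (sameCycle_face_apply R κ (by simp [localRot_inl_of_neg R h])).trans ih

theorem face_inl_apply (H : IsMatched α κ σ θ dir) (e : E) :
    (localRot R * linkOpp κ).SameCycle (.inl e) (.inl ((σ * α) e)) := by
  refine Perm.SameCycle.symm ?_
  obtain ⟨x, rfl⟩ := α.surjective e
  simp only [Perm.mul_apply, R.invol]
  by_cases hx : dir x = 1
  · have h2 := H.dir_theta_symm hx
    obtain ⟨m, rfl⟩ := θ.surjective x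
    rw [Equiv.symm_apply_apply] at h2
    have h3 := face_inr_of_descent R H (H.descent m h2)
    rw [← H.apply_of_ne (by simp [R.dir_apply, h2]), Equiv.symm_apply_apply] at h3
    rw [← H.apply_eq]
    exact (sameCycle_face_apply R κ (by simp [localRot_inr_of_one R h2])).trans h3
  · rw [← H.apply_of_ne hx]
    exact sameCycle_face_apply R κ (by simp [localRot_inr_of_ne R hx])

/-- A letter without descent has minimal height around its vertex of `P`. The face of `M` through it
visits the letters of minimal height in order, skipping matched pairs, so all of them share one
face. -/
theorem face_inr_pow (H : IsMatched α κ σ θ dir) (hh : ∀ x, h (σ x) = h x - (dir x : ℚ))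
    (n : ℕ) : ∀ e : E, (¬ ∃ g, FirstDescent σ dir e g) →
      (¬ ∃ g, FirstDescent σ dir ((σ ^ n) e) g) →
      (localRot R * linkOpp κ).SameCycle (.inr (κ.symm e)) (.inr (κ.symm ((σ ^ n) e))) := by
  induction n using Nat.strong_induction_on with
  | _ n ih =>
    intro e he hn
    rcases n with _ | n
    · exact Perm.SameCycle.refl _ _
    rcases SignType.trichotomy (dir e) with hd | hd | hd
    · have hb := H.descent_opening R hd
      have hκ := H.ascend_apply R hd hb
      have hstep : (localRot R * linkOpp κ).SameCycle (.inr (κ.symm e))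
          (.inr (κ.symm (σ (θ (α e))))) :=
        sameCycle_face_apply R κ (by simp [localRot_inl_of_neg R hd, hκ])
      obtain ⟨i, hi, h1, h2⟩ := hb.spec hh
      have h3 : h (σ (θ (α e))) = h e := by
        rw [hh, h1, hb.dir_eq_one, hh, hd]; simp
      have he' : ¬ ∃ g, FirstDescent σ dir (σ (θ (α e))) g := by
        rintro ⟨g, hg⟩
        exact he ⟨g, .ascend hd hb hg⟩
      by_cases hin : i < n
      · obtain ⟨l, rfl⟩ : ∃ l, n = l + (i + 1) := ⟨n - (i + 1), by omega⟩
        have hp : (σ ^ l) (σ (θ (α e))) = (σ ^ (l + (i + 1) + 1)) e := by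
          rw [hi]
          exact FirstDescent.pow_apply_bridge σ l i e
        rw [← hp] at hn ⊢
        exact hstep.trans (ih l (by omega) _ he' hn)
      -- Here the target would lie inside the matched pair opened by `e`, hence strictly above the
      -- minimum, and would have a descent.
      · exfalso
        apply hn
        obtain ⟨l, rfl⟩ : ∃ l, i = l + n := ⟨i - n, by omega⟩
        have h4 := h2 n (by omega)
        rw [hh, hd] at h4
        have h5 : (σ ^ (l + 1)) ((σ ^ (n + 1)) e) = σ (θ (α e)) := by
          rw [hi, pow_succ', Perm.mul_apply, pow_succ, Perm.mul_apply, pow_add, Perm.mul_apply]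
        obtain ⟨j, -, hj⟩ := FirstDescent.exists_of_lt hh (l + 1) ((σ ^ (n + 1)) e) (by
          rw [h5, h3, pow_succ, Perm.mul_apply]
          simp at h4
          linarith)
        exact ⟨_, hj⟩
    · have he' : ¬ ∃ g, FirstDescent σ dir (σ e) g := by
        rintro ⟨g, hg⟩
        exact he ⟨g, .level hd hg⟩
      rw [pow_succ, Perm.mul_apply] at hn ⊢
      refine Perm.SameCycle.trans ?_ (ih n (by omega) (σ e) he' hn)
      refine sameCycle_face_apply R κ ?_
      simp [localRot_inl_of_zero R hd, ← H.apply_of_ne (x := e) (by simp [hd])]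
    · exact (he ⟨e, .here hd⟩).elim

variable [Finite E]

/-- Faces of the quartic map are faces or vertices of the partially oriented map. -/
theorem IsMatched.card_faces (H : IsMatched α κ σ θ dir)
    (hh : ∀ x, h (σ x) = h x - (dir x : ℚ)) :
    Nat.card (PermCycles (localRot R * linkOpp κ)) =
      Nat.card (PermCycles (σ * α)) + Nat.card (PermCycles σ) := by
  rw [← Nat.card_sum]
  let F : PermCycles (localRot R * linkOpp κ) → PermCycles (σ * α) ⊕ PermCycles σ :=
    Quotient.lift (faceLabel α κ σ dir) fun a b hab =>
      Perm.SameCycle.rel (Setoid.ker (faceLabel α κ σ dir))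
        (fun d => (faceLabel_face R H d).symm) hab
  have hinl : ∀ {e e' : E}, (σ * α).SameCycle e e' →
      (localRot R * linkOpp κ).SameCycle (.inl e) (.inl e') := fun he =>
    he.rel ((Perm.SameCycle.setoid (localRot R * linkOpp κ)).comap Sum.inl)
      (fun e => face_inl_apply R H e)
  -- Every dart either shares its face with an out-dart, which names a face of `P`, or is an in-dart
  -- leading to a letter of minimal height, which names a vertex of `P`.
  have hnormal : ∀ d : E ⊕ E,
      (∃ e, (localRot R * linkOpp κ).SameCycle d (.inl e) ∧
        faceLabel α κ σ dir d = .inl (Quotient.mk _ e)) ∨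
      (∃ e, d = .inr (κ.symm e) ∧ (¬ ∃ g, FirstDescent σ dir e g) ∧
        faceLabel α κ σ dir d = .inr (Quotient.mk _ e)) := by
    rintro (e | m)
    · exact Or.inl ⟨e, Perm.SameCycle.refl _ _, rfl⟩
    · by_cases hex : ∃ g, FirstDescent σ dir (κ m) g
      · obtain ⟨g, hg⟩ := hex
        have := face_inr_of_descent R H hg
        rw [Equiv.symm_apply_apply] at this
        exact Or.inl ⟨α g, this, leftFace_of_descent hg⟩
      · exact Or.inr ⟨κ m, by simp, hex, leftFace_of_not hex⟩
  refine Nat.card_congr (Equiv.ofBijective F ⟨?_, ?_⟩)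
  · rintro ⟨a⟩ ⟨b⟩ hab
    refine Quotient.sound ?_
    change (localRot R * linkOpp κ).SameCycle a b
    change faceLabel α κ σ dir a = faceLabel α κ σ dir b at hab
    rcases hnormal a with ⟨e, he, hea⟩ | ⟨e, rfl, he, hea⟩ <;>
      rcases hnormal b with ⟨e', he', hea'⟩ | ⟨e', rfl, he', hea'⟩ <;> rw [hea, hea'] at hab
    · exact he.trans ((hinl (Quotient.exact (Sum.inl_injective hab))).trans he'.symm)
    · cases hab
    · cases hab
    · obtain ⟨n, hn⟩ := Perm.SameCycle.exists_nat_pow_eq (f := σ)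
        (Quotient.exact (Sum.inr_injective hab))
      subst hn
      exact face_inr_pow R H hh n e he he'
  · rintro (q | q)
    · induction q using Quotient.inductionOn with | h e => ?_
      exact ⟨Quotient.mk _ (.inl e), rfl⟩
    · induction q using Quotient.inductionOn with | h e => ?_
      -- The face for a vertex of `P` is found at a letter of minimal height around it, since a
      -- descent would reach a lower one.
      have hfin : {y | σ.SameCycle e y}.Finite := Set.toFinite _
      obtain ⟨y, hy, hmin⟩ := hfin.exists_minimalFor h _ ⟨e, Perm.SameCycle.refl _ _⟩
      have hy' : ¬ ∃ g, FirstDescent σ dir y g := by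
        rintro ⟨g, hg⟩
        obtain ⟨-, -, h1, -⟩ := hg.spec hh
        have h2 : h (σ g) = h y - 1 := by rw [hh, h1, hg.dir_eq_one]; simp
        have h3 := hmin (j := σ g) (Perm.sameCycle_apply_right.2 (hy.trans hg.sameCycle))
          (by rw [h2]; linarith)
        linarith
      refine ⟨Quotient.mk _ (.inr (κ.symm y)), ?_⟩
      change leftFace α σ dir (κ (κ.symm y)) = _
      rw [Equiv.apply_symm_apply, leftFace_of_not hy', Sum.inr.injEq]
      exact Quotient.sound hy.symm

/-- Euler's relation for the quartic map and for the partially oriented map. -/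
theorem IsMatched.planar_iff (hne : ∀ x, α x ≠ x) (H : IsMatched α κ σ θ dir)
    (hh : ∀ x, h (σ x) = h x - (dir x : ℚ)) :
    Nat.card (PermCycles σ) + Nat.card (PermCycles (σ * α)) = Nat.card (PermCycles α) + 2 ↔
    Nat.card (PermCycles (localRot R)) + Nat.card (PermCycles (localRot R * linkOpp κ)) =
      Nat.card (PermCycles (linkOpp κ)) + 2 := by
  rw [H.card_faces R hh, Nat.card_congr (vertexEquivEdge R),
    card_cycles_linkOpp κ hne R.invol]
  omega

end Matched

/-! ### Heights on the faces, by a discrete Hodge decomposition -/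

section Height

open Finset

variable {D : Type} [Fintype D]

/-- Gradients of functions on the vertices and on the faces are orthogonal. -/
theorem sum_gradient_mul_gradient_eq_zero {rot opp : Perm D} (hopp : ∀ d, opp (opp d) = d)
    {f g : D → ℚ} (hf : ∀ d, f (rot d) = f d) (hg : ∀ d, g (rot (opp d)) = g d) :
    ∑ d, (f d - f (opp d)) * (g d - g (opp d)) = 0 := by
  have h1 : ∑ d, f d * (g d - g (opp d)) = 0 := by
    have e : ∀ d, g (opp d) = g (rot d) := fun d => by rw [← hg (opp d), hopp]
    simp only [mul_sub, sum_sub_distrib, e, sub_eq_zero]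
    rw [← Equiv.sum_comp rot (fun d => f d * g d)]
    simp [hf]
  have h2 : ∑ d, f (opp d) * (g d - g (opp d)) = 0 := by
    rw [← Equiv.sum_comp opp]
    simp only [hopp]
    rw [← neg_eq_zero, ← sum_neg_distrib, ← h1]
    exact sum_congr rfl fun d _ => by ring
  simp only [sub_mul, sum_sub_distrib, h1, h2, sub_zero]

theorem sum_vertex_mul_dir_eq_zero (M : PartialEulerian D) (f : M.Vertex → ℚ) :
    ∑ d, f (M.vertexOf d) * (M.dir d : ℚ) = 0 := by
  classical
  have := Fintype.ofFinite M.Vertex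
  rw [← sum_fiberwise univ M.vertexOf]
  refine sum_eq_zero fun v _ => ?_
  have h := (card_eq_iff_sum_dir_eq_zero M.dir (fun d => M.vertexOf d = v)).1 (M.eulerian v)
  calc ∑ d with M.vertexOf d = v, f (M.vertexOf d) * (M.dir d : ℚ)
      = ∑ d with M.vertexOf d = v, f v * (M.dir d : ℚ) :=
        sum_congr rfl fun d hd => by rw [(mem_filter.1 hd).2]
    _ = 0 := by
        rw [← mul_sum]
        exact mul_eq_zero_of_right _ (by convert h)

theorem SignType.cast_neg_rat (s : SignType) : ((-s : SignType) : ℚ) = -(s : ℚ) := by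
  rcases SignType.trichotomy s with h | h | h <;> simp [h]

/-- A partial Eulerian orientation of a planar map is the gradient of a height function on the
faces. -/
theorem PartialEulerian.exists_height (M : PartialEulerian D) :
    ∃ h : D → ℚ, (∀ d, h (M.rot (M.opp d)) = h d) ∧
      ∀ d, h d - h (M.opp d) = (M.dir d : ℚ) := by
  have := Fintype.ofFinite M.Vertex
  have := Fintype.ofFinite M.Edge
  have := Fintype.ofFinite (PermCycles (M.rot * M.opp))
  let eo : D → M.Edge := fun d => Quotient.mk _ d
  let vo : D → M.Vertex := fun d => Quotient.mk _ d
  let fo : D → PermCycles (M.rot * M.opp) := fun d => Quotient.mk _ d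
  have heo : ∀ d, eo (M.opp d) = eo d := fun d =>
    Quotient.sound (Perm.sameCycle_apply_left.2 (Perm.SameCycle.refl _ _))
  have hvo : ∀ d, vo (M.rot d) = vo d := fun d =>
    Quotient.sound (Perm.sameCycle_apply_left.2 (Perm.SameCycle.refl _ _))
  have hfo : ∀ d, fo (M.rot (M.opp d)) = fo d := fun d =>
    Quotient.sound (Perm.sameCycle_apply_left.2 (Perm.SameCycle.refl (M.rot * M.opp) _))
  have orth : ∀ (f : M.Vertex → ℚ) (g : PermCycles (M.rot * M.opp) → ℚ),
      ∑ d, (f (vo d) - f (vo (M.opp d))) * (g (fo d) - g (fo (M.opp d))) = 0 := fun f g =>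
    sum_gradient_mul_gradient_eq_zero (f := fun d => f (vo d)) (g := fun d => g (fo d))
      M.opp_opp (fun d => by rw [hvo]) (fun d => by rw [hfo])
  have conn := (transitive_closure_pair_iff M.rot M.opp).1 M.connected
  -- A function on darts is to be split into a symmetric part, a gradient from the vertices and a
  -- gradient from the faces. The two extra coordinates fix the additive constants of the
  -- potentials.
  let L : ((M.Edge → ℚ) × (M.Vertex → ℚ) × (PermCycles (M.rot * M.opp) → ℚ)) →ₗ[ℚ]
      (D → ℚ) × ℚ × ℚ :=
    { toFun := fun x => (fun d => x.1 (eo d) + (x.2.1 (vo d) - x.2.1 (vo (M.opp d))) +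
        (x.2.2 (fo d) - x.2.2 (fo (M.opp d))), x.2.1 (vo M.root), x.2.2 (fo M.root))
      map_add' := fun x y => by
        refine Prod.ext ?_ (Prod.ext rfl rfl)
        funext d
        simp only [Prod.fst_add, Prod.snd_add, Pi.add_apply]
        ring
      map_smul' := fun c x => by
        refine Prod.ext ?_ (Prod.ext rfl rfl)
        funext d
        simp only [Prod.smul_fst, Prod.smul_snd, Pi.smul_apply, smul_eq_mul, RingHom.id_apply]
        ring }
  have hLapp : ∀ s f g d, (L (s, f, g)).1 d = s (eo d) + (f (vo d) - f (vo (M.opp d))) +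
      (g (fo d) - g (fo (M.opp d))) := fun _ _ _ _ => rfl
  -- The symmetric part vanishes on an antisymmetric function.
  have hs0 : ∀ s f g, (∀ d, (L (s, f, g)).1 (M.opp d) = -(L (s, f, g)).1 d) → s = 0 := by
    intro s f g H
    funext e
    induction e using Quotient.inductionOn with
    | h d =>
      have := H d
      rw [hLapp, hLapp, heo, M.opp_opp] at this
      change s (eo d) = 0
      linarith
  have hvconst : ∀ f : M.Vertex → ℚ, (∀ d, f (vo d) - f (vo (M.opp d)) = 0) →
      ∀ d, f (vo d) = f (vo M.root) := by
    intro f H d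
    exact conn (Setoid.ker fun d => f (vo d))
      (fun x => by change f (vo x) = f (vo (M.rot x)); rw [hvo])
      (fun x => sub_eq_zero.1 (H x)) d M.root
  have hfconst : ∀ f : PermCycles (M.rot * M.opp) → ℚ, (∀ d, f (fo d) - f (fo (M.opp d)) = 0) →
      ∀ d, f (fo d) = f (fo M.root) := by
    intro f H d
    refine conn (Setoid.ker fun d => f (fo d)) (fun x => ?_)
      (fun x => sub_eq_zero.1 (H x)) d M.root
    change f (fo x) = f (fo (M.rot x))
    have := hfo (M.opp x)
    rw [M.opp_opp] at this
    rw [this, sub_eq_zero.1 (H x)]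
  have hinj : Function.Injective L := by
    rw [← LinearMap.ker_eq_bot, LinearMap.ker_eq_bot']
    rintro ⟨s, f, g⟩ H
    have H1 : ∀ d, (L (s, f, g)).1 d = 0 := fun d => by rw [H]; rfl
    have Hf : f (vo M.root) = 0 := congrArg (fun y => y.2.1) H
    have Hg : g (fo M.root) = 0 := congrArg (fun y => y.2.2) H
    have hs := hs0 s f g (fun d => by rw [H1, H1, neg_zero])
    subst hs
    have hfg : ∀ d, g (fo d) - g (fo (M.opp d)) = -(f (vo d) - f (vo (M.opp d))) := by
      intro d
      have := H1 d
      rw [hLapp] at this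
      simp only [Pi.zero_apply] at this
      linarith
    -- On the kernel the two gradients are opposite, and they are orthogonal, so the sum of squares
    -- vanishes.
    have hsq : ∑ d, (f (vo d) - f (vo (M.opp d))) * (f (vo d) - f (vo (M.opp d))) = 0 := by
      have := orth f g
      simp only [hfg, mul_neg, sum_neg_distrib, neg_eq_zero] at this
      exact this
    have hf0 : ∀ d, f (vo d) - f (vo (M.opp d)) = 0 := fun d =>
      mul_self_eq_zero.1 ((sum_eq_zero_iff_of_nonneg fun d _ => mul_self_nonneg _).1 hsq d
        (mem_univ d))
    have hf : f = 0 := by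
      funext v
      induction v using Quotient.inductionOn with
      | h d => exact (hvconst f hf0 d).trans Hf
    have hg : g = 0 := by
      funext v
      induction v using Quotient.inductionOn with
      | h d => exact (hfconst g (fun d => by rw [hfg, hf0, neg_zero]) d).trans Hg
    rw [hf, hg]
    rfl
  -- Euler's relation enters here: edges + vertices + faces = 2 · edges + 2, so no harmonic part is
  -- left.
  have hdim : Module.finrank ℚ
      ((M.Edge → ℚ) × (M.Vertex → ℚ) × (PermCycles (M.rot * M.opp) → ℚ)) =
      Module.finrank ℚ ((D → ℚ) × ℚ × ℚ) := by
    have h1 : Nat.card M.Vertex + Nat.card (PermCycles (M.rot * M.opp)) = Nat.card M.Edge + 2 :=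
      M.planar
    have h2 : Nat.card D = 2 * Nat.card M.Edge := card_eq_two_mul_of_involutive M.opp_opp M.opp_ne
    simp only [Module.finrank_prod, Module.finrank_fintype_fun_eq_card, Module.finrank_self]
    simp only [Nat.card_eq_fintype_card] at h1 h2
    omega
  obtain ⟨⟨s, f, g⟩, hsfg⟩ := (LinearMap.injective_iff_surjective_of_finrank_eq_finrank hdim).1
    hinj (fun d => (M.dir d : ℚ), 0, 0)
  have H1 : ∀ d, (L (s, f, g)).1 d = M.dir d := fun d => by rw [hsfg]
  have hs := hs0 s f g (fun d => by rw [H1, H1, M.dir_opp, SignType.cast_neg_rat])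
  subst hs
  have hfg : ∀ d, (M.dir d : ℚ) = (f (vo d) - f (vo (M.opp d))) +
      (g (fo d) - g (fo (M.opp d))) := by
    intro d
    rw [← H1 d, hLapp]
    simp
  -- The Eulerian condition makes `dir` orthogonal to gradients from the vertices, so its vertex
  -- component is zero.
  have hd0 : ∑ d, (f (vo d) - f (vo (M.opp d))) * (M.dir d : ℚ) = 0 := by
    have h1 : ∑ d, f (vo d) * (M.dir d : ℚ) = 0 := sum_vertex_mul_dir_eq_zero M f
    have h2 : ∑ d, f (vo (M.opp d)) * (M.dir d : ℚ) = 0 := by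
      rw [← Equiv.sum_comp M.opp]
      simp only [M.opp_opp, M.dir_opp, SignType.cast_neg_rat, mul_neg, sum_neg_distrib, h1,
        neg_zero]
    simp only [sub_mul, sum_sub_distrib, h1, h2, sub_zero]
  have hsq : ∑ d, (f (vo d) - f (vo (M.opp d))) * (f (vo d) - f (vo (M.opp d))) = 0 := by
    simp only [hfg, mul_add, sum_add_distrib, orth, add_zero] at hd0
    exact hd0
  have hf0 : ∀ d, f (vo d) - f (vo (M.opp d)) = 0 := fun d =>
    mul_self_eq_zero.1 ((sum_eq_zero_iff_of_nonneg fun d _ => mul_self_nonneg _).1 hsq d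
      (mem_univ d))
  refine ⟨fun d => g (fo d), fun d => congrArg g (hfo d), fun d => ?_⟩
  rw [hfg, hf0, zero_add]

end Height

/-! ### Transport along a bijection of darts -/

section Transport

variable {A B : Type}

theorem Equiv.Perm.SameCycle.map {p : Perm A} {q : Perm B} (f : A → B)
    (h : ∀ x, f (p x) = q (f x)) {x y : A} (H : p.SameCycle x y) : q.SameCycle (f x) (f y) :=
  H.rel ((Perm.SameCycle.setoid q).comap f) fun x => by
    change q.SameCycle (f x) (f (p x))
    rw [h]
    exact Perm.sameCycle_apply_right.2 (Perm.SameCycle.refl _ _)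

theorem sameCycle_iff_of_equiv {p : Perm A} {q : Perm B} (f : A ≃ B)
    (h : ∀ x, f (p x) = q (f x)) (x y : A) : p.SameCycle x y ↔ q.SameCycle (f x) (f y) := by
  refine ⟨fun H => H.map f h, fun H => ?_⟩
  have := H.map (p := q) (q := p) f.symm (fun x => by
    rw [Equiv.symm_apply_eq, h, Equiv.apply_symm_apply])
  simpa using this

/-- Conjugate permutations have the same cycles. -/
def cyclesCongr {p : Perm A} {q : Perm B} (f : A ≃ B) (h : ∀ x, f (p x) = q (f x)) :
    PermCycles p ≃ PermCycles q :=
  Quotient.congr f (sameCycle_iff_of_equiv f h)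

theorem transitive_iff_of_equiv {p q : Perm A} {p' q' : Perm B} (f : A ≃ B)
    (hp : ∀ x, f (p x) = p' (f x)) (hq : ∀ x, f (q x) = q' (f x)) :
    (∀ x y : A, ∃ g ∈ Subgroup.closure ({p, q} : Set (Perm A)), g x = y) ↔
      ∀ x y : B, ∃ g ∈ Subgroup.closure ({p', q'} : Set (Perm B)), g x = y := by
  rw [transitive_closure_pair_iff, transitive_closure_pair_iff]
  constructor
  · intro H r h1 h2 x y
    have := H (r.comap f) (fun x => by change r _ _; rw [hp]; exact h1 _)
      (fun x => by change r _ _; rw [hq]; exact h2 _) (f.symm x) (f.symm y)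
    change r _ _ at this
    simpa using this
  · intro H r h1 h2 x y
    have := H (r.comap f.symm) (fun x => by
        obtain ⟨x, rfl⟩ := f.surjective x
        change r _ _
        rw [← hp, Equiv.symm_apply_apply, Equiv.symm_apply_apply]
        exact h1 _)
      (fun x => by
        obtain ⟨x, rfl⟩ := f.surjective x
        change r _ _
        rw [← hq, Equiv.symm_apply_apply, Equiv.symm_apply_apply]
        exact h2 _) (f x) (f y)
    change r _ _ at this
    simpa using this

theorem planar_iff_of_equiv {p q : Perm A} {p' q' : Perm B} (f : A ≃ B)
    (hp : ∀ x, f (p x) = p' (f x)) (hq : ∀ x, f (q x) = q' (f x)) :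
    Nat.card (PermCycles p) + Nat.card (PermCycles (p * q)) = Nat.card (PermCycles q) + 2 ↔
      Nat.card (PermCycles p') + Nat.card (PermCycles (p' * q')) =
        Nat.card (PermCycles q') + 2 := by
  rw [Nat.card_congr (cyclesCongr f hp), Nat.card_congr (cyclesCongr f hq),
    Nat.card_congr (cyclesCongr (p := p * q) (q := p' * q') f fun x => by simp [hp, hq])]

end Transport

/-! ### Recovering labels and directions from the rotation -/

section LocalShape

variable {E : Type} {α : Perm E} {dir : E → SignType} (R : Reverses α dir) (m : E)

theorem isLeft_localRot_inl : (localRot R (.inl m)).isLeft ↔ dir m = 1 := by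
  rcases SignType.trichotomy (dir m) with h | h | h <;> simp [localRot, h]

theorem isLeft_localRot_localRot_inl :
    (localRot R (localRot R (.inl m))).isLeft ↔ dir m = 0 := by
  rcases SignType.trichotomy (dir m) with h | h | h <;> simp [localRot, h, R.dir_apply]

theorem inr_eq_localRot : (.inr m : E ⊕ E) =
    if dir m = 0 then localRot R (.inl m) else localRot R (localRot R (.inl m)) := by
  rcases SignType.trichotomy (dir m) with h | h | h <;>
    simp [localRot, h, R.dir_apply, R.invol]

theorem inl_eq_localRot : (.inl (α m) : E ⊕ E) =
    if dir m = 1 then localRot R (.inl m) else localRot R (.inr m) := by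
  rcases SignType.trichotomy (dir m) with h | h | h <;> simp [localRot, h]

end LocalShape

/-! ### Encodings and their compatibility with isomorphisms -/

namespace PartialEulerian

variable {D E : Type}

theorem reverses (P : PartialEulerian E) : Reverses P.opp P.dir := ⟨P.opp_opp, P.dir_opp⟩

/-- A description of the quartic orientation `M` that corresponds to `P`: its outgoing darts
are labelled by the darts of `P`. -/
structure Encoding (M : PartialEulerian D) (P : PartialEulerian E) where
  label : E ⊕ E ≃ D
  link : Perm E
  matching : Perm E
  matched : IsMatched P.opp link P.rot matching P.dir
  rot_label : ∀ x, M.rot (label x) = label (localRot P.reverses x)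
  opp_label : ∀ x, M.opp (label x) = label (linkOpp link x)
  dir_inl : ∀ e, M.dir (label (.inl e)) = 1
  dir_inr : ∀ e, M.dir (label (.inr e)) = -1
  root_label : label (.inl P.root) = M.root

theorem exists_rot_height [Fintype E] (P : PartialEulerian E) :
    ∃ h : E → ℚ, ∀ x, h (P.rot x) = h x - (P.dir x : ℚ) := by
  classical
  refine exists_height_of_balanced _ fun v => ?_
  convert (card_eq_iff_sum_dir_eq_zero P.dir (fun d => P.vertexOf d = v)).1 (P.eulerian v)
  rfl

theorem exists_quartic_encoding [Fintype E] (P : PartialEulerian E) (u : E ⊕ E ≃ D) :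
    ∃ M : Quartic D, Nonempty (Encoding M.1 P) := by
  obtain ⟨h, hh⟩ := P.exists_rot_height
  obtain ⟨κ, θ, H⟩ := exists_isMatched_of_rot P.reverses hh
  have hrot : ∀ x, u (localRot P.reverses x) = u.permCongr (localRot P.reverses) (u x) := by
    intro x; simp
  have hopp : ∀ x, u (linkOpp κ x) = u.permCongr (linkOpp κ) (u x) := by
    intro x; simp
  let M₀ : RootedPlanarMap D :=
    { rot := u.permCongr (localRot P.reverses)
      opp := u.permCongr (linkOpp κ)
      opp_opp := fun d => by simp [linkOpp_linkOpp]
      opp_ne := fun d hd => by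
        rw [Equiv.permCongr_apply, ← Equiv.eq_symm_apply] at hd
        exact linkOpp_ne κ _ hd
      root := u (.inl P.root)
      connected := (transitive_iff_of_equiv u hrot hopp).1
        ((H.transitive_iff P.reverses).1 P.connected)
      planar := (planar_iff_of_equiv u hrot hopp).1
        ((H.planar_iff P.reverses P.opp_ne hh).1 P.planar) }
  let dirQ : E ⊕ E → SignType := Sum.elim (fun _ => 1) (fun _ => -1)
  have hvert : ∀ x y, M₀.vertexOf (u x) = M₀.vertexOf (u y) ↔
      (Quotient.mk _ (baseDart x) : PermCycles P.opp) = Quotient.mk _ (baseDart y) := by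
    intro x y
    refine Iff.trans Quotient.eq (Iff.trans ?_ Quotient.eq.symm)
    exact (sameCycle_iff_of_equiv u hrot x y).symm.trans (sameCycle_localRot_iff _ x y)
  have htwo := card_cycle_of_involutive P.opp_opp P.opp_ne
  let M₁ : PartialEulerian D :=
    { M₀ with
      dir := fun d => dirQ (u.symm d)
      dir_opp := fun d => by
        obtain ⟨x, rfl⟩ := u.surjective d
        change dirQ (u.symm (u.permCongr (linkOpp κ) (u x))) = _
        rw [← hopp, Equiv.symm_apply_apply, Equiv.symm_apply_apply]
        rcases x with e | e <;> simp [dirQ]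
      eulerian := fun v => by
        obtain ⟨d, rfl⟩ := Quotient.exists_rep v
        obtain ⟨y, rfl⟩ := u.surjective d
        have key : ∀ s : SignType, Nat.card {d : D // M₀.vertexOf d = M₀.vertexOf (u y) ∧
            dirQ (u.symm d) = s} =
            Nat.card {x : E ⊕ E // (Quotient.mk _ (baseDart x) : PermCycles P.opp) =
              Quotient.mk _ (baseDart y) ∧ dirQ x = s} := fun s =>
          (Nat.card_congr (u.subtypeEquiv fun x => by simp [hvert])).symm
        refine (key 1).trans (Eq.trans ?_ (key (-1)).symm)
        rw [Nat.card_congr Equiv.subtypeSum, Nat.card_congr Equiv.subtypeSum, Nat.card_sum,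
          Nat.card_sum]
        simp [dirQ, baseDart] }
  refine ⟨⟨M₁, ?_, ?_, ?_⟩, ⟨u, κ, θ, H, fun x => (hrot x).symm, fun x => (hopp x).symm, ?_, ?_,
    rfl⟩⟩
  · intro v
    obtain ⟨d, rfl⟩ := Quotient.exists_rep v
    obtain ⟨y, rfl⟩ := u.surjective d
    have key : Nat.card {d : D // M₀.vertexOf d = M₀.vertexOf (u y)} =
        Nat.card {x : E ⊕ E // (Quotient.mk _ (baseDart x) : PermCycles P.opp) =
          Quotient.mk _ (baseDart y)} :=
      (Nat.card_congr (u.subtypeEquiv fun x => by simp [hvert])).symm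
    refine key.trans ?_
    rw [Nat.card_congr Equiv.subtypeSum, Nat.card_sum]
    exact congrArg₂ (· + ·) (htwo _) (htwo _)
  · intro d
    change dirQ (u.symm d) ≠ 0
    rcases u.symm d with e | e <;> simp [dirQ]
  · change dirQ (u.symm (u (.inl P.root))) = 1
    simp [dirQ]
  · intro e
    change dirQ (u.symm (u (.inl e))) = 1
    simp [dirQ]
  · intro e
    change dirQ (u.symm (u (.inr e))) = -1
    simp [dirQ]

namespace Encoding

theorem undirectedCount_eq {M : PartialEulerian D} {P : PartialEulerian E} (c : Encoding M P) :
    M.alternatingCount = P.undirectedCount := by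
  let W : P.Edge ≃ M.Vertex :=
    (vertexEquivEdge P.reverses).symm.trans
      (cyclesCongr c.label fun x => (c.rot_label x).symm)
  refine (Nat.card_congr (W.subtypeEquiv fun e => ?_)).symm
  induction e using Quotient.inductionOn with | h e => ?_
  have hmem : ∀ x, M.vertexOf (c.label x) = W (Quotient.mk _ e) ↔
      P.opp.SameCycle (baseDart x) e := fun x =>
    Quotient.eq.trans ((sameCycle_iff_of_equiv c.label (fun x => (c.rot_label x).symm) x
      (.inl e)).symm.trans (sameCycle_localRot_iff _ x (.inl e)))
  constructor
  · intro H d hd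
    obtain ⟨x, rfl⟩ := c.label.surjective d
    have h0 : P.dir (baseDart x) = 0 := H _ (Quotient.sound ((hmem x).1 hd))
    rw [c.rot_label]
    rcases x with m | m
    · rw [localRot_inl_of_zero _ (show P.dir m = 0 from h0), c.dir_inl, c.dir_inr]
    · rw [localRot_inr_of_ne _ (by rw [show P.dir m = 0 from h0]; simp), c.dir_inl, c.dir_inr]
      rfl
  · intro H d hd
    have hd' : P.opp.SameCycle d e := Quotient.exact hd
    have key : ∀ m, P.opp.SameCycle m e → P.dir m ≠ 1 := by
      intro m hm h1
      have := H (c.label (.inl m)) ((hmem (.inl m)).2 hm)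
      rw [c.rot_label, localRot_inl_of_one _ h1, c.dir_inl, c.dir_inl] at this
      exact absurd this (by decide)
    rcases SignType.trichotomy (P.dir d) with h | h | h
    · exact (key (P.opp d) (Perm.sameCycle_apply_left.2 hd') (by simp [P.dir_opp, h])).elim
    · exact h
    · exact (key d hd' h).elim

/-- An isomorphism of the quartic orientations preserves outgoing darts and so induces `k` on
labels. Directions, `α`, the pairing of in-darts with out-darts and `κ` are all read off the
rotation and the edges, so `k` respects them; `equivariant_left` then yields the rotation. -/
theorem exists_iso_partial {M M' : PartialEulerian D} {P P' : PartialEulerian E}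
    (c : Encoding M P) (c' : Encoding M' P') {f : Perm D} (hf : IsIso f M M') :
    ∃ k : Perm E, IsIso k P P' := by
  let g : E ⊕ E ≃ E ⊕ E := c.label.trans (f.trans c'.label.symm)
  have hg : ∀ x, c'.label (g x) = f (c.label x) := fun x => by simp [g]
  have hrot : ∀ x, g (localRot P.reverses x) = localRot P'.reverses (g x) := by
    intro x
    apply c'.label.injective
    rw [hg, ← c.rot_label, hf.rot, ← c'.rot_label, hg]
  have hopp : ∀ x, g (linkOpp c.link x) = linkOpp c'.link (g x) := by
    intro x
    apply c'.label.injective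
    rw [hg, ← c.opp_label, hf.opp, ← c'.opp_label, hg]
  have hdir : ∀ x, M'.dir (c'.label (g x)) = M.dir (c.label x) := fun x => by rw [hg, hf.dir]
  have hleft : ∀ x, (g x).isLeft ↔ x.isLeft := by
    intro x
    have := hdir x
    rcases hx : g x with e' | e' <;> rcases x with e | e <;> rw [hx] at this <;>
      simp [c.dir_inl, c.dir_inr, c'.dir_inl, c'.dir_inr] at this ⊢
  have hex : ∀ e, ∃ e', g (.inl e) = .inl e' := fun e => by
    obtain ⟨e', he'⟩ := Sum.isLeft_iff.1 ((hleft (.inl e)).2 rfl)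
    exact ⟨e', he'⟩
  choose k hk using hex
  have hd : ∀ m, P'.dir (k m) = P.dir m := by
    intro m
    have h1 : P'.dir (k m) = 1 ↔ P.dir m = 1 := by
      rw [← isLeft_localRot_inl P'.reverses, ← isLeft_localRot_inl P.reverses, ← hk, ← hrot, hleft]
    have h2 : P'.dir (k m) = 0 ↔ P.dir m = 0 := by
      rw [← isLeft_localRot_localRot_inl P'.reverses, ← isLeft_localRot_localRot_inl P.reverses,
        ← hk, ← hrot, ← hrot, hleft]
    rcases SignType.trichotomy (P.dir m) with h | h | h
    · rcases SignType.trichotomy (P'.dir (k m)) with h' | h' | h'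
      · rw [h, h']
      · simp [h2.1 h'] at h
      · simp [h1.1 h'] at h
    · rw [h, h2.2 h]
    · rw [h, h1.2 h]
  have hr : ∀ m, g (.inr m) = .inr (k m) := by
    intro m
    rw [inr_eq_localRot P.reverses m, inr_eq_localRot P'.reverses (k m), hd]
    split_ifs <;> simp only [hrot, hk]
  have hα : ∀ m, k (P.opp m) = P'.opp (k m) := by
    intro m
    apply Sum.inl_injective (β := E)
    rw [← hk, inl_eq_localRot P.reverses m, inl_eq_localRot P'.reverses (k m), hd]
    split_ifs <;> simp only [hrot, hk, hr]
  have hinj : Function.Bijective k := by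
    constructor
    · intro a b hab
      exact Sum.inl_injective (g.injective (by rw [hk, hk, hab]))
    · intro b
      obtain ⟨x, hx⟩ := g.surjective (.inl b)
      rcases x with a | a
      · exact ⟨a, Sum.inl_injective ((hk a).symm.trans hx)⟩
      · simp [hr] at hx
  let K : Perm E := Equiv.ofBijective k hinj
  have hlink : ∀ m, k (c.link m) = c'.link (k m) := by
    intro m
    apply Sum.inl_injective (β := E)
    rw [← hk, ← linkOpp_inr, hopp, hr, linkOpp_inr]
  refine ⟨K, ⟨?_, hα, ?_, hd⟩⟩
  · exact c.matched.equivariant_left P.reverses P'.reverses c'.matched K hα hd hlink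
  · apply Sum.inl_injective (β := E)
    apply c'.label.injective
    change c'.label (.inl (k P.root)) = _
    rw [← hk, hg, c.root_label, hf.root, c'.root_label]

theorem exists_iso_quartic {M M' : PartialEulerian D} {P P' : PartialEulerian E}
    (c : Encoding M P) (c' : Encoding M' P') {k : Perm E} (hk : IsIso k P P') :
    ∃ f : Perm D, IsIso f M M' := by
  let f : Perm D := c.label.symm.trans ((Equiv.sumCongr k k).trans c'.label)
  have hf : ∀ x, f (c.label x) = c'.label (Sum.map k k x) := fun x => by simp [f]
  have hlink := c.matched.equivariant_right c'.matched k hk.opp hk.dir hk.rot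
  refine ⟨f, ⟨?_, ?_, ?_, ?_⟩⟩
  · intro d
    obtain ⟨x, rfl⟩ := c.label.surjective d
    rw [c.rot_label, hf, hf, c'.rot_label]
    congr 1
    rcases x with m | m <;> rcases SignType.trichotomy (P.dir m) with h | h | h <;>
      simp [localRot, h, hk.dir, hk.opp]
  · intro d
    obtain ⟨x, rfl⟩ := c.label.surjective d
    rw [c.opp_label, hf, hf, c'.opp_label]
    congr 1
    rcases x with m | m
    · obtain ⟨m, rfl⟩ := c.link.surjective m
      simp [hlink]
    · simp [hlink]
  · rw [← c.root_label, hf, ← c'.root_label, Sum.map_inl, hk.root]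
  · intro d
    obtain ⟨x, rfl⟩ := c.label.surjective d
    rw [hf]
    rcases x with m | m
    · simp [c.dir_inl, c'.dir_inl]
    · simp [c.dir_inr, c'.dir_inr]

end Encoding

end PartialEulerian

/-! ### From a quartic orientation to a partial orientation -/

namespace PartialEulerian

variable {D : Type} [Fintype D]

namespace IsQuarticOrientation

variable {M : PartialEulerian D}

theorem minimalPeriod_rot (hM : M.IsQuarticOrientation) (d : D) : Function.minimalPeriod M.rot d = 4 := by
  classical
  have h1 : Function.minimalPeriod M.rot d =
      Nat.card (MulAction.orbit (Subgroup.zpowers M.rot) d) := by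
    rw [Nat.card_eq_fintype_card]
    exact MulAction.minimalPeriod_eq_card (a := M.rot) (b := d)
  rw [h1, ← hM.degree (M.vertexOf d)]
  refine Nat.card_congr (Equiv.subtypeEquivRight fun x => ?_)
  refine Iff.trans ?_ Quotient.eq.symm
  change _ ↔ M.rot.SameCycle x d
  rw [Perm.sameCycle_comm]
  constructor
  · rintro ⟨⟨g, i, rfl⟩, rfl⟩
    exact ⟨i, rfl⟩
  · rintro ⟨i, rfl⟩
    exact ⟨⟨M.rot ^ i, i, rfl⟩, rfl⟩

theorem rot_four (hM : M.IsQuarticOrientation) (d : D) : M.rot (M.rot (M.rot (M.rot d))) = d := by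
  have := Function.iterate_minimalPeriod (f := M.rot) (x := d)
  rwa [hM.minimalPeriod_rot] at this

theorem rot_two_ne (hM : M.IsQuarticOrientation) (d : D) : M.rot (M.rot d) ≠ d := by
  intro h
  exact Function.not_isPeriodicPt_of_pos_of_lt_minimalPeriod (f := M.rot) (x := d) (n := 2)
    (by norm_num) (by rw [hM.minimalPeriod_rot]; norm_num) h

/-- The three possible shapes of a vertex, read from an outgoing dart. -/
theorem dir_rot_cases (hM : M.IsQuarticOrientation) {d : D} (hd : M.dir d = 1) :
    (M.dir (M.rot d) = 1 ∧ M.dir (M.rot (M.rot d)) = -1 ∧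
      M.dir (M.rot (M.rot (M.rot d))) = -1) ∨
    (M.dir (M.rot d) = -1 ∧ M.dir (M.rot (M.rot d)) = 1 ∧
      M.dir (M.rot (M.rot (M.rot d))) = -1) ∨
    (M.dir (M.rot d) = -1 ∧ M.dir (M.rot (M.rot d)) = -1 ∧
      M.dir (M.rot (M.rot (M.rot d))) = 1) := by
  classical
  have h4 : M.rot ^ 4 = 1 := by
    ext d
    exact hM.rot_four d
  have hsum := sum_range_pow_eq_zero h4 (fun d => (M.dir d : ℚ)) (fun v => by
    convert (card_eq_iff_sum_dir_eq_zero M.dir (fun d => M.vertexOf d = v)).1 (M.eulerian v)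
    rfl) d
  simp only [Finset.sum_range_succ, Finset.sum_range_zero, pow_succ, pow_zero, Perm.mul_apply,
    Perm.one_apply, one_mul, zero_add, hd] at hsum
  have hpm : ∀ d, M.dir d = 1 ∨ M.dir d = -1 := by
    intro d
    rcases SignType.trichotomy (M.dir d) with h | h | h
    · exact Or.inr h
    · exact (hM.directed d h).elim
    · exact Or.inl h
  rcases hpm (M.rot d) with h1 | h1 <;> rcases hpm (M.rot (M.rot d)) with h2 | h2 <;>
    rcases hpm (M.rot (M.rot (M.rot d))) with h3 | h3 <;> rw [h1, h2, h3] at hsum <;>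
    simp [h1, h2, h3] <;> norm_num at hsum

theorem card_outgoing (hM : M.IsQuarticOrientation) : 2 * Nat.card {d // M.dir d = 1} = Nat.card D := by
  have h1 : Nat.card {d // M.dir d = 1} = Nat.card {d // ¬ M.dir d = 1} := by
    refine Nat.card_congr (M.opp.subtypeEquiv fun d => ?_)
    rw [M.dir_opp]
    rcases SignType.trichotomy (M.dir d) with h | h | h
    · rw [h]; decide
    · exact (hM.directed d h).elim
    · rw [h]; decide
  classical
  rw [← Nat.card_congr (Equiv.sumCompl fun d => M.dir d = 1), Nat.card_sum, ← h1, two_mul]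

end IsQuarticOrientation

section Extraction

variable (M : PartialEulerian D)

open Classical in
/-- The direction of the edge corresponding to the vertex of `d`, read along `d`. -/
noncomputable def vertexDir (d : D) : SignType :=
  if M.dir (M.rot d) = 1 then 1 else if M.dir (M.rot (M.rot d)) = 1 then 0 else -1

open Classical in
/-- The other outgoing dart at the vertex of an outgoing dart. -/
noncomputable def coDart (d : D) : D :=
  if M.dir (M.rot d) = 1 then M.rot d else
    if M.dir (M.rot (M.rot d)) = 1 then M.rot (M.rot d) else M.rot (M.rot (M.rot d))

open Classical in
/-- The incoming dart paired with an outgoing dart. -/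
noncomputable def inDart (d : D) : D :=
  if M.dir (M.rot d) = 1 then M.rot (M.rot d) else
    if M.dir (M.rot (M.rot d)) = 1 then M.rot d else M.rot (M.rot d)

open Classical in
/-- The outgoing dart paired with an incoming dart. -/
noncomputable def outDart (d : D) : D :=
  if M.dir (M.rot (M.rot d)) = 1 then M.rot (M.rot d) else M.rot (M.rot (M.rot d))

variable {M} {d : D}

theorem dir_coDart (hM : M.IsQuarticOrientation) (hd : M.dir d = 1) : M.dir (M.coDart d) = 1 := by
  rcases hM.dir_rot_cases hd with ⟨h1, h2, h3⟩ | ⟨h1, h2, h3⟩ | ⟨h1, h2, h3⟩ <;>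
    simp [coDart, h1, h2, h3]

theorem dir_inDart (hM : M.IsQuarticOrientation) (hd : M.dir d = 1) : M.dir (M.inDart d) = -1 := by
  rcases hM.dir_rot_cases hd with ⟨h1, h2, h3⟩ | ⟨h1, h2, h3⟩ | ⟨h1, h2, h3⟩ <;>
    simp [inDart, h1, h2]

theorem coDart_coDart (hM : M.IsQuarticOrientation) (hd : M.dir d = 1) : M.coDart (M.coDart d) = d := by
  rcases hM.dir_rot_cases hd with ⟨h1, h2, h3⟩ | ⟨h1, h2, h3⟩ | ⟨h1, h2, h3⟩ <;>
    simp [coDart, h1, h2, h3, hM.rot_four, hd]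

theorem coDart_ne (hM : M.IsQuarticOrientation) (hd : M.dir d = 1) : M.coDart d ≠ d := by
  rcases hM.dir_rot_cases hd with ⟨h1, h2, h3⟩ | ⟨h1, h2, h3⟩ | ⟨h1, h2, h3⟩ <;>
    simp only [coDart, h1, h2, if_true, if_neg (show ¬ (-1 : SignType) = 1 by decide)]
  · intro h
    rw [h, h1] at h2
    exact absurd h2 (by decide)
  · exact hM.rot_two_ne d
  · intro h
    have := hM.rot_four d
    rw [h] at this
    rw [this, hd] at h1
    exact absurd h1 (by decide)

theorem vertexDir_coDart (hM : M.IsQuarticOrientation) (hd : M.dir d = 1) :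
    M.vertexDir (M.coDart d) = - M.vertexDir d := by
  rcases hM.dir_rot_cases hd with ⟨h1, h2, h3⟩ | ⟨h1, h2, h3⟩ | ⟨h1, h2, h3⟩ <;>
    simp [vertexDir, coDart, h1, h2, h3, hM.rot_four, hd]

theorem outDart_inDart (hM : M.IsQuarticOrientation) (hd : M.dir d = 1) : M.outDart (M.inDart d) = d := by
  rcases hM.dir_rot_cases hd with ⟨h1, h2, h3⟩ | ⟨h1, h2, h3⟩ | ⟨h1, h2, h3⟩ <;>
    simp [outDart, inDart, h1, h2, h3, hM.rot_four, hd]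

theorem rot_outgoing (hM : M.IsQuarticOrientation) (hd : M.dir d = 1) :
    M.rot d = if M.vertexDir d = 1 then M.coDart d else
    if M.vertexDir d = 0 then M.inDart d else M.inDart (M.coDart d) := by
  rcases hM.dir_rot_cases hd with ⟨h1, h2, h3⟩ | ⟨h1, h2, h3⟩ | ⟨h1, h2, h3⟩ <;>
    simp [vertexDir, inDart, coDart, h1, h2, hM.rot_four, hd]

theorem rot_inDart (hM : M.IsQuarticOrientation) (hd : M.dir d = 1) : M.rot (M.inDart d) =
    if M.vertexDir d = 1 then M.inDart (M.coDart d) else M.coDart d := by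
  rcases hM.dir_rot_cases hd with ⟨h1, h2, h3⟩ | ⟨h1, h2, h3⟩ | ⟨h1, h2, h3⟩ <;>
    simp [vertexDir, inDart, coDart, h1, h2, h3]

end Extraction

theorem exists_partial_encoding {E : Type} [Fintype E] {M : PartialEulerian D}
    (hM : M.IsQuarticOrientation) (hcard : Nat.card D = 2 * Nat.card E) :
    ∃ P : PartialEulerian E, Nonempty (Encoding M P) := by
  classical
  obtain ⟨ε⟩ : Nonempty (E ≃ {d // M.dir d = 1}) := by
    rw [← Finite.card_eq]
    have := hM.card_outgoing
    omega
  have hε : ∀ e, M.dir (ε e).1 = 1 := fun e => (ε e).2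
  let α : Perm E := Function.Involutive.toPerm
    (fun e => ε.symm ⟨M.coDart (ε e).1, dir_coDart hM (hε e)⟩) (fun e => by
      simp [coDart_coDart hM (hε e)])
  have hα : ∀ e, (ε (α e)).1 = M.coDart (ε e).1 := fun e => by
    change (ε (ε.symm _)).1 = _
    rw [Equiv.apply_symm_apply]
  let dirE : E → SignType := fun e => M.vertexDir (ε e).1
  have R : Reverses α dirE := ⟨fun e => by
    apply ε.injective
    apply Subtype.ext
    rw [hα, hα, coDart_coDart hM (hε e)], fun e => by
    change M.vertexDir (ε (α e)).1 = _
    rw [hα, vertexDir_coDart hM (hε e)]⟩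
  have hαne : ∀ e, α e ≠ e := by
    intro e h
    have := hα e
    rw [h] at this
    exact coDart_ne hM (hε e) this.symm
  let u₀ : E ⊕ E → D := Sum.elim (fun e => (ε e).1) (fun e => M.inDart (ε e).1)
  have hu₀r : ∀ e, M.dir (u₀ (.inr e)) = -1 := fun e => dir_inDart hM (hε e)
  have hu₀l : ∀ e, M.dir (u₀ (.inl e)) = 1 := hε
  have hinj : Function.Injective u₀ := by
    rintro (a | a) (b | b) hab
    · exact congrArg _ (ε.injective (Subtype.ext hab))
    · have := hu₀r b
      rw [← hab, hu₀l] at this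
      exact absurd this (by decide)
    · have := hu₀r a
      rw [hab, hu₀l] at this
      exact absurd this (by decide)
    · have := congrArg M.outDart hab
      change M.outDart (M.inDart (ε a).1) = M.outDart (M.inDart (ε b).1) at this
      rw [outDart_inDart hM (hε a), outDart_inDart hM (hε b)] at this
      exact congrArg _ (ε.injective (Subtype.ext this))
  let u : E ⊕ E ≃ D := Equiv.ofBijective u₀ ((Nat.bijective_iff_injective_and_card u₀).2
    ⟨hinj, by rw [Nat.card_sum, hcard, two_mul]⟩)
  have hrot : ∀ x, M.rot (u x) = u (localRot R x) := by
    rintro (e | e)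
    · change M.rot (ε e).1 = u₀ (if dirE e = 1 then _ else if dirE e = 0 then _ else _)
      rw [rot_outgoing hM (hε e)]
      simp only [apply_ite u₀, u₀, Sum.elim_inl, Sum.elim_inr, hα]
      rfl
    · change M.rot (M.inDart (ε e).1) = u₀ (if dirE e = 1 then _ else _)
      rw [rot_inDart hM (hε e)]
      simp only [apply_ite u₀, u₀, Sum.elim_inl, Sum.elim_inr, hα]
      rfl
  have hkdir : ∀ e, M.dir (M.opp (u (.inr e))) = 1 := fun e => by
    rw [M.dir_opp, show M.dir (u (.inr e)) = -1 from hu₀r e]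
    rfl
  let κ₀ : E → E := fun e => ε.symm ⟨M.opp (u (.inr e)), hkdir e⟩
  have hκ₀ : ∀ e, u (.inl (κ₀ e)) = M.opp (u (.inr e)) := fun e => by
    change (ε (ε.symm _)).1 = _
    rw [Equiv.apply_symm_apply]
  have hκinj : Function.Injective κ₀ := by
    intro a b hab
    have := hκ₀ a
    rw [hab, hκ₀ b] at this
    exact (Sum.inr_injective (u.injective (M.opp.injective this))).symm
  let κ : Perm E := Equiv.ofBijective κ₀ (Finite.injective_iff_bijective.1 hκinj)
  have hκ : ∀ e, M.opp (u (.inr e)) = u (.inl (κ e)) := fun e => (hκ₀ e).symm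
  have hopp : ∀ x, M.opp (u x) = u (linkOpp κ x) := by
    rintro (e | e)
    · obtain ⟨m, rfl⟩ := κ.surjective e
      rw [linkOpp_inl, Equiv.symm_apply_apply, ← hκ, M.opp_opp]
    · exact hκ e
  obtain ⟨H, H1, H2⟩ := M.exists_height
  let h : E → ℚ := fun e => H (u (.inl e))
  -- Crossing an edge changes the height by the direction, and following a face leaves it unchanged.
  -- Applied at each corner of the three vertex shapes, these rules give the drop of `h` along `α`
  -- and `κ`.
  have hin : ∀ m, H (u (.inr m)) = h (κ m) - 1 := by
    intro m
    have := H2 (u (.inr m))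
    rw [hκ, show M.dir (u (.inr m)) = -1 from hu₀r m] at this
    simp only [SignType.coe_neg_one] at this
    simp only [h]
    linarith
  have hA : ∀ e, H (u (localRot R (.inl e))) = h e - 1 := by
    intro e
    obtain ⟨m, rfl⟩ := κ.surjective e
    rw [← hin, ← H1 (u (.inr m)), hκ, hrot]
  have hB : ∀ m, H (u (localRot R (.inr m))) = h (κ m) := by
    intro m
    rw [← hrot, show u (.inr m) = M.opp (u (.inl (κ m))) by rw [← hκ, M.opp_opp], H1]
  have hone : ∀ e, dirE e = 1 → h (α e) = h e - 1 := by
    intro e he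
    rw [← hA, localRot_inl_of_one R he]
  have hzero : ∀ e, dirE e = 0 → h (κ e) = h e := by
    intro e he
    have := hA e
    rw [localRot_inl_of_zero R he, hin] at this
    linarith
  have hneg : ∀ e, dirE e = -1 → h (κ (α e)) = h e := by
    intro e he
    have := hA e
    rw [localRot_inl_of_neg R he, hin] at this
    linarith
  have hle : ∀ e, dirE e ≠ 1 → h (κ e) = h (α e) := by
    intro e he
    rw [← hB, localRot_inr_of_ne R he]
  have hhα : ∀ e, h (α e) = h e - (dirE e : ℚ) := by
    intro e
    rcases SignType.trichotomy (dirE e) with he | he | he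
    · have := hone (α e) (by simp [R.dir_apply, he])
      rw [R.invol] at this
      rw [he]
      simp only [SignType.coe_neg_one]
      linarith
    · rw [← hle e (by simp [he]), hzero e he, he]
      simp
    · rw [hone e he, he]
      simp
  have hhκ : ∀ e, h (κ e) = h e - (dirE e : ℚ) := by
    intro e
    by_cases he : dirE e = 1
    · have := hneg (α e) (by simp [R.dir_apply, he])
      rw [R.invol, hone e he] at this
      rw [this, he]
      simp
    · rw [hle e he, hhα]
  obtain ⟨σ, θ, hmatch, hσ⟩ := exists_isMatched_of_link R hhκ hhα
  let P : PartialEulerian E :=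
    { rot := σ
      opp := α
      opp_opp := R.invol
      opp_ne := hαne
      root := ε.symm ⟨M.root, hM.root_dir⟩
      connected := (hmatch.transitive_iff R).2
        ((transitive_iff_of_equiv u (fun x => (hrot x).symm) (fun x => (hopp x).symm)).2
          M.connected)
      planar := (hmatch.planar_iff R hαne hσ).2
        ((planar_iff_of_equiv u (fun x => (hrot x).symm) (fun x => (hopp x).symm)).2 M.planar)
      dir := dirE
      dir_opp := R.dir_apply
      eulerian := fun v => (card_eq_iff_sum_dir_eq_zero dirE _).2 (by
        convert sum_cycle_eq_zero_of_height hσ v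
        rfl) }
  refine ⟨P, ⟨u, κ, θ, hmatch, hrot, hopp, hu₀l, hu₀r, ?_⟩⟩
  change (ε (ε.symm _)).1 = _
  rw [Equiv.apply_symm_apply]

/-- Each class is sent to a partial orientation encoding its chosen representative. Lifting
isomorphisms from `P` to `M` gives injectivity; encoding an arbitrary `P` and pushing isomorphisms
from `M` to `P` gives surjectivity. -/
theorem sum_alternatingCount_eq_sum_undirectedCount (n : ℕ) :
    ∑ c : QuarticClass n, (Polynomial.X : Polynomial ℕ) ^ c.alternatingCount =
      ∑ c : PartialClass n, (Polynomial.X : Polynomial ℕ) ^ c.undirectedCount := by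
  have hcard : Nat.card (Fin (4 * n)) = 2 * Nat.card (Fin (2 * n)) := by
    simp only [Nat.card_eq_fintype_card, Fintype.card_fin]
    omega
  have hex : ∀ c : QuarticClass n, ∃ P : PartialEulerian (Fin (2 * n)),
      Nonempty (Encoding c.out.1 P) := fun c => exists_partial_encoding c.out.2 hcard
  choose F hF using hex
  refine Fintype.sum_bijective (fun c => (Quotient.mk _ (F c) : PartialClass n)) ⟨?_, ?_⟩ _ _ ?_
  · intro c c' h
    obtain ⟨k, hk⟩ : ∃ k, IsIso k (F c) (F c') := Quotient.exact h
    rw [← Quotient.out_eq c, ← Quotient.out_eq c']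
    exact Quotient.sound ((hF c).some.exists_iso_quartic (hF c').some hk)
  · intro q
    induction q using Quotient.inductionOn with | h P => ?_
    obtain ⟨M, ⟨e⟩⟩ := P.exists_quartic_encoding
      (finSumFinEquiv.trans (finCongr (by omega)) : Fin (2 * n) ⊕ Fin (2 * n) ≃ Fin (4 * n))
    let c : QuarticClass n := Quotient.mk _ M
    obtain ⟨f, hf⟩ : ∃ f, IsIso f c.out.1 M.1 := Quotient.exact (Quotient.out_eq c)
    exact ⟨c, Quotient.sound ((hF c).some.exists_iso_partial e hf)⟩
  · intro c
    have h1 : c.alternatingCount = c.out.1.alternatingCount := by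
      conv_lhs => rw [← Quotient.out_eq c]
      rfl
    rw [h1, (hF c).some.undirectedCount_eq]
    rfl

end PartialEulerian

theorem mainTheorem6 : quarticSeries = partialSeries := by
  refine PowerSeries.ext fun n => ?_
  rw [quarticSeries, partialSeries, PowerSeries.coeff_mk, PowerSeries.coeff_mk]
  exact PartialEulerian.sum_alternatingCount_eq_sum_undirectedCount n
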